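/- \textbf{Setting.} Let $k$ be a field, let $F$ and $G$ be finite groups, and let $(G,F,\rhd,\lhd)$ be a matched pair: a left action $\rhd$ of $G$ on the set $F$ and a right action $\lhd$ of $F$ on the set $G$ with $$s\rhd xy=(s\rhd x)\big((s\lhd x)\rhd y\big),\qquad st\lhd x=\big(s\lhd(t\rhd x)\big)(t\lhd x)\qquad(s,t\in G,\ x,y\in F).$$ Let $\Sigma=F\bowtie G$ be the set $F\times G$ with the group law $(x,s)(y,t)=(x(s\rhd y),(s\lhd y)t)$. An \emph{extension} of $kF$ by $k^G$ is a sequence $k\to k^G\xrightarrow{i}A\xrightarrow{\pi}kF\to k$ of finite-dimensional Hopf algebras and Hopf algebra maps with $i$ injective, $\pi$ surjective and $i(k^G)=A^{\operatorname{co}kF}=\{a:(\mathrm{id}\otimes\pi)\Delta(a)=a\otimes1\}$. Two extensions $A,A'$ are \emph{equivalent} if there is a Hopf algebra map $f:A\to A'$ with $fi=i'$ and $\pi'f=\pi$. An \emph{abelian extension} associated to the matched pair is an extension of the form $A=k^G\#_{\sigma,\tau}kF$: it has a basis $e_s\#x$ ($s\in G$, $x\in F$) with $$(e_s\#x)(e_t\#y)=\delta_{s\lhd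 x,t}\,\sigma(s;x,y)\,e_s\#xy,\qquad \Delta(e_s\#x)=\sum_{s=ab}\tau(a,b;x)\,e_a\#(b\rhd x)\otimes e_b\#x,$$ $i(e_s)=e_s\#1$ and $\pi(e_s\#x)=\delta_{s,1}x$, where $\sigma\in Z^2(F,(k^G)^\times)$ and $\tau\in Z^2(G,(k^F)^\times)$ are normalized 2-cocycles that are compatible: $$\sigma(st;x,y)\,\tau(s,t;xy)=\sigma(s;t\rhd x,(t\lhd x)\rhd y)\,\sigma(t;x,y)\,\tau(s,t;x)\,\tau(s\lhd(t\rhd x),t\lhd x;y).$$ Let $\operatorname{Opext}_{\rhd,\lhd}(kF,k^G)$ be the set of equivalence classes of abelian extensions associated to the matched pair. The \emph{Baer product} of $A_1$ and $A_2$ is the image of the cotensor product $A_1\mathbin{\square}A_2=\{t\in A_1\otimes A_2:\text{the two right }kF\text{-coactions on }t\text{ agree}\}$ in $A_1\otimes_{k^G}A_2$ (with $k^G$ acting by left multiplication on both factors); its product is induced by that of the subalgebra $A_1\mathbin{\square}A_2\subseteq A_1\otimes A_2$, its coproduct by that of the quotient coalgebra $A_1\otimes_{k^G}A_2$ of $A_1\otimes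 A_2$, and its maps from $k^G$ and to $kF$ are induced by $f\mapsto i_1(f)\otimes1$ and $\pi_1\otimes\varepsilon$. Let $X=F\sqcup G$ be the left $\Sigma$-set in which $(f,g)\cdot x=f(g\rhd x)$ for $x\in F$, and in which $\Sigma$ acts on $G$ on the left through the inverse by means of the right action $s\cdot(f,g)=(s\lhd f)g$. Let $\Lambda_X=\ker(\mathbb Z[X]\to\mathbb Z,\ x\mapsto1)$, and for a $\mathbb Z\Sigma$-module $M$ let $H^n_{\mathscr A}(\Sigma,X;M)=\operatorname{Ext}^{n-1}_{\mathbb Z\Sigma}(\Lambda_X,M)$, $n\ge1$. \textbf{Theorem.} The set $\operatorname{Opext}_{\rhd,\lhd}(kF,k^G)$ is an abelian group under the Baer product, and there is an isomorphism of groups $$\operatorname{Opext}_{\rhd,\lhd}(kF,k^G)\;\cong\;H^3_{\mathscr A}(\Sigma,X;k^\times)=\operatorname{Ext}^2_{\mathbb Z\Sigma}(\Lambda_X,k^\times),$$ where $k^\times$ is the trivial $\Sigma$-module. -/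

import Mathlib

open scoped TensorProduct

universe u

/-! ### Matched pairs of groups -/

/-- A matched pair of groups `(G, F, ▷, ◁)`: a left action `▷` of `G` on the set `F` and a right
action `◁` of `F` on the set `G`, subject to the two compatibility conditions. -/
structure MatchedPair (G F : Type u) [Group G] [Group F] where
  /-- `lact s x = s ▷ x` -/
  lact : G → F → F
  /-- `ract s x = s ◁ x` -/
  ract : G → F → G
  one_lact : ∀ x, lact 1 x = x
  mul_lact : ∀ s t x, lact (s * t) x = lact s (lact t x)
  ract_one : ∀ s, ract s 1 = s
  ract_mul : ∀ s x y, ract s (x * y) = ract (ract s x) y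
  lact_mul : ∀ s x y, lact s (x * y) = lact s x * lact (ract s x) y
  mul_ract : ∀ s t x, ract (s * t) x = ract s (lact t x) * ract t x

namespace MatchedPair

variable {G F : Type u} [Group G] [Group F] (M : MatchedPair G F)

theorem lact_one (s : G) : M.lact s 1 = 1 := by
  have h := M.lact_mul s 1 1
  rw [mul_one, M.ract_one] at h
  simpa using h

theorem one_ract (x : F) : M.ract 1 x = 1 := by
  have h := M.mul_ract 1 1 x
  rw [mul_one, M.one_lact] at h
  simpa using h

/-- The group `F ⋈ G` of a matched pair: the set `F × G` with the product
`(x, s) (y, t) = (x (s ▷ y), (s ◁ y) t)`. -/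
@[ext]
structure Bowtie {G F : Type u} [Group G] [Group F] (M : MatchedPair G F) : Type u where
  fst : F
  snd : G

namespace Bowtie

instance : Mul M.Bowtie := ⟨fun p q => ⟨p.fst * M.lact p.snd q.fst, M.ract p.snd q.fst * q.snd⟩⟩

instance : One M.Bowtie := ⟨⟨1, 1⟩⟩

instance : Inv M.Bowtie :=
  ⟨fun p => ⟨M.lact p.snd⁻¹ p.fst⁻¹, M.ract p.snd⁻¹ p.fst⁻¹⟩⟩

@[simp] theorem fst_mul (p q : M.Bowtie) : (p * q).fst = p.fst * M.lact p.snd q.fst := rfl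
@[simp] theorem snd_mul (p q : M.Bowtie) : (p * q).snd = M.ract p.snd q.fst * q.snd := rfl
@[simp] theorem fst_one : (1 : M.Bowtie).fst = 1 := rfl
@[simp] theorem snd_one : (1 : M.Bowtie).snd = 1 := rfl
@[simp] theorem fst_inv (p : M.Bowtie) : (p⁻¹).fst = M.lact p.snd⁻¹ p.fst⁻¹ := rfl
@[simp] theorem snd_inv (p : M.Bowtie) : (p⁻¹).snd = M.ract p.snd⁻¹ p.fst⁻¹ := rfl

instance : Group M.Bowtie :=
  Group.ofLeftAxioms
    (fun p q r => by
      ext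
      · simp [M.lact_mul, M.mul_lact, mul_assoc]
      · simp [M.mul_ract, M.ract_mul, mul_assoc])
    (fun p => by ext <;> simp [M.one_lact, M.one_ract])
    (fun p => by
      have h1 : M.lact (M.ract p.snd⁻¹ p.fst⁻¹) p.fst = (M.lact p.snd⁻¹ p.fst⁻¹)⁻¹ := by
        have h := M.lact_mul p.snd⁻¹ p.fst⁻¹ p.fst
        rw [inv_mul_cancel, M.lact_one] at h
        exact eq_inv_of_mul_eq_one_right h.symm
      ext
      · simp [h1]
      · simp [← M.ract_mul, M.ract_one])

end Bowtie

/-- The left `F ⋈ G`-set `X = F ⊔ G`: here `F = Σ/G` carries the left action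
`(f, g) x = f (g ▷ x)`, and `G = F\Σ` the right action `s (f, g) = (s ◁ f) g`, turned into a left
action by means of the inverse. -/
inductive CosetSet {G F : Type u} [Group G] [Group F] (M : MatchedPair G F) : Type u
  | inF (x : F) : CosetSet M
  | inG (s : G) : CosetSet M

instance : SMul M.Bowtie M.CosetSet :=
  ⟨fun p z => match z with
    | .inF x => .inF (p.fst * M.lact p.snd x)
    | .inG s => .inG (M.ract s p⁻¹.fst * p⁻¹.snd)⟩

theorem smul_inF (p : M.Bowtie) (x : F) :
    p • (CosetSet.inF x : M.CosetSet) = .inF (p.fst * M.lact p.snd x) := rfl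

theorem smul_inG (p : M.Bowtie) (s : G) :
    p • (CosetSet.inG s : M.CosetSet) = .inG (M.ract s p⁻¹.fst * p⁻¹.snd) := rfl

instance : MulAction M.Bowtie M.CosetSet where
  one_smul z := by
    cases z with
    | inF x => simp [smul_inF, M.one_lact]
    | inG s => rw [smul_inG, inv_one]; simp [M.ract_one]
  mul_smul p q z := by
    cases z with
    | inF x => simp [smul_inF, M.lact_mul, M.mul_lact, mul_assoc]
    | inG s =>
      rw [smul_inG, smul_inG, smul_inG, mul_inv_rev, Bowtie.fst_mul, Bowtie.snd_mul,
        M.mul_ract, M.ract_mul, mul_assoc]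

end MatchedPair

/-! ### Relative group cohomology in the sense of Auslander -/

section RelativeCohomology

variable (S : Type u) [Group S] (X : Type u) [MulAction S X]

/-- The `ℤS`-module `ℤ[X]` of an `S`-set `X`. -/
noncomputable abbrev PermModule : Type u := (Representation.ofMulAction ℤ S X).asModule

/-- An abelian group with the trivial action of `S`, as a `ℤS`-module. -/
noncomputable abbrev TrivModule (A : Type*) [AddCommGroup A] : Type _ :=
  (Representation.trivial ℤ S A).asModule

/-- The augmentation `ε_X : ℤ[X] → ℤ`, `x ↦ 1`, as a `ℤS`-linear map. -/
noncomputable def augmentation : PermModule S X →ₗ[MonoidAlgebra ℤ S] TrivModule S ℤ :=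
  Representation.IntertwiningMap.equivLinearMapAsModule
    (Representation.ofMulAction ℤ S X) (Representation.trivial ℤ S ℤ)
    { toLinearMap := (Finsupp.linearCombination ℤ fun _ : X => (1 : ℤ)) ∘ₗ
        (MonoidAlgebra.coeffLinearEquiv ℤ).toLinearMap
      isIntertwining' := fun g => by ext x; simp }

theorem augmentation_single (x : X) (n : ℤ) :
    augmentation S X ((Representation.asModuleEquiv _).symm (MonoidAlgebra.single x n)) =
      (Representation.asModuleEquiv _).symm n := by
  change Finsupp.linearCombination ℤ (fun _ : X => (1 : ℤ))
    (MonoidAlgebra.coeffLinearEquiv ℤ (MonoidAlgebra.single x n)) = n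
  simp

/-- `Λ_X`, the kernel of the augmentation map. -/
noncomputable def augKernel : ModuleCat.{u} (MonoidAlgebra ℤ S) :=
  ModuleCat.of _ (LinearMap.ker (augmentation S X))

/-- `H^n_𝒜(S, X; A) = Ext^{n-1}_{ℤS}(Λ_X, A)`, for `n ≥ 1`. -/
abbrev AuslanderCohomology (A : Type u) [AddCommGroup A] [Module (MonoidAlgebra ℤ S) A]
    (n : ℕ) : Type u :=
  CategoryTheory.Abelian.Ext.{u} (augKernel S X) (ModuleCat.of (MonoidAlgebra ℤ S) A) (n - 1)

end RelativeCohomology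

/-! ### The Hopf algebra `k^G` -/

/-- The algebra `k^G` of functions on `G`, with pointwise operations. -/
def FunctionAlgebra (k G : Type u) : Type u := G → k

namespace FunctionAlgebra

variable (k : Type u) {G : Type u} [Field k]

set_option linter.unusedSectionVars false

instance : CommRing (FunctionAlgebra k G) := inferInstanceAs (CommRing (G → k))
instance : Algebra k (FunctionAlgebra k G) := inferInstanceAs (Algebra k (G → k))

open Classical in
/-- The idempotent `e_s`, the indicator function of `s`. -/
noncomputable def e (s : G) : FunctionAlgebra k G := fun t => if t = s then 1 else 0

variable {k}

@[ext] theorem ext {f g : FunctionAlgebra k G} (h : ∀ s, f s = g s) : f = g := funext h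

@[simp] theorem add_apply (f g : FunctionAlgebra k G) (s : G) : (f + g) s = f s + g s := rfl
@[simp] theorem mul_apply (f g : FunctionAlgebra k G) (s : G) : (f * g) s = f s * g s := rfl
@[simp] theorem one_apply (s : G) : (1 : FunctionAlgebra k G) s = 1 := rfl
@[simp] theorem zero_apply (s : G) : (0 : FunctionAlgebra k G) s = 0 := rfl
@[simp] theorem smul_apply (c : k) (f : FunctionAlgebra k G) (s : G) : (c • f) s = c * f s := rfl
theorem algebraMap_apply (c : k) (s : G) : algebraMap k (FunctionAlgebra k G) c s = c := rfl

open Classical in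
theorem e_apply (s t : G) : e k s t = if t = s then 1 else 0 := rfl

open Classical in
theorem e_mul (s : G) (f : FunctionAlgebra k G) : e k s * f = f s • e k s := by
  ext t
  by_cases h : t = s <;> simp [e_apply, h]

/-- Evaluation at `s`. -/
def eval (s : G) : FunctionAlgebra k G →ₐ[k] k := Pi.evalAlgHom k (fun _ => k) s

@[simp] theorem eval_apply (s : G) (f : FunctionAlgebra k G) : eval s f = f s := rfl

variable [Fintype G]

theorem sum_apply {ι : Type*} (t : Finset ι) (f : ι → FunctionAlgebra k G) (s : G) :
    (∑ i ∈ t, f i) s = ∑ i ∈ t, f i s :=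
  map_sum (eval s) f t

theorem sum_smul_e (f : FunctionAlgebra k G) : ∑ s, f s • e k s = f := by
  classical
  ext t
  rw [sum_apply, Finset.sum_eq_single t] <;> simp +contextual [e_apply, eq_comm]

theorem sum_e : ∑ s, e k s = (1 : FunctionAlgebra k G) := by
  simpa using sum_smul_e (1 : FunctionAlgebra k G)

theorem linearMap_ext {W : Type*} [AddCommGroup W] [Module k W]
    {φ ψ : FunctionAlgebra k G →ₗ[k] W} (h : ∀ s, φ (e k s) = ψ (e k s)) : φ = ψ := by
  ext f
  rw [← sum_smul_e f]
  simp [h]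

variable [Group G]

/-- Left translation `(f ↦ f (a * ·))`. -/
def translate (a : G) : FunctionAlgebra k G →ₐ[k] FunctionAlgebra k G where
  toFun f := fun b => f (a * b)
  map_one' := rfl
  map_mul' _ _ := rfl
  map_zero' := rfl
  map_add' _ _ := rfl
  commutes' _ := rfl

@[simp] theorem translate_apply (a b : G) (f : FunctionAlgebra k G) :
    translate a f b = f (a * b) := rfl

theorem translate_e (a s : G) : translate a (e k s) = e k (a⁻¹ * s) := by
  ext b
  have h : a * b = s ↔ b = a⁻¹ * s := eq_inv_mul_iff_mul_eq.symm
  by_cases hb : a * b = s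
  · simp [e_apply, h.1 hb]
  · simp [e_apply, hb, mt h.2 hb]

/-- The comultiplication of `k^G`, dual to the product of `G`: it is
`f ↦ ∑ a, ∑ b, f (a * b) • e_a ⊗ e_b`, i.e. `e_s ↦ ∑_{ab = s} e_a ⊗ e_b`. -/
noncomputable def comulLin :
    FunctionAlgebra k G →ₗ[k] FunctionAlgebra k G ⊗[k] FunctionAlgebra k G :=
  ∑ a, (TensorProduct.mk k _ _ (e k a)) ∘ₗ (translate a).toLinearMap

theorem comulLin_apply (f : FunctionAlgebra k G) :
    comulLin f = ∑ a, e k a ⊗ₜ[k] translate a f := by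
  simp [comulLin]

theorem comulLin_e (s : G) :
    comulLin (e k s) = ∑ a, e k a ⊗ₜ[k] e k (a⁻¹ * s) := by
  simp [comulLin_apply, translate_e]

noncomputable instance : Bialgebra k (FunctionAlgebra k G) :=
  Bialgebra.ofAlgHom
    (AlgHom.ofLinearMap comulLin
      (by
        simp only [comulLin_apply, map_one, ← TensorProduct.sum_tmul, sum_e]
        rfl)
      (fun f g => by
        classical
        simp only [comulLin_apply, map_mul, Finset.sum_mul_sum,
          Algebra.TensorProduct.tmul_mul_tmul, e_mul, e_apply,
          ite_smul, one_smul, zero_smul, TensorProduct.ite_tmul]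
        simp))
    (eval 1)
    (by
      apply AlgHom.toLinearMap_injective
      apply linearMap_ext
      intro s
      have h1 : ∀ a : G, comulLin (e k a) = ∑ c, e k c ⊗ₜ[k] e k (c⁻¹ * a) := comulLin_e
      simp [comulLin_e, TensorProduct.sum_tmul, TensorProduct.tmul_sum]
      rw [Finset.sum_comm]
      refine Finset.sum_congr rfl fun c _ => ?_
      refine Fintype.sum_equiv (Equiv.mulLeft c⁻¹) _ _ fun a => ?_
      simp [mul_assoc])
    (by
      apply AlgHom.toLinearMap_injective
      apply linearMap_ext
      intro s
      simp [comulLin_e]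
      rw [Finset.sum_eq_single 1]
      · simp [e_apply]
      · intro b _ hb
        simp [e_apply, hb.symm]
      · simp)
    (by
      apply AlgHom.toLinearMap_injective
      apply linearMap_ext
      intro s
      simp [comulLin_e]
      rw [Finset.sum_eq_single s]
      · simp [e_apply]
      · intro b _ hb
        have h : ¬ 1 = b⁻¹ * s := fun h => hb (by simpa using (mul_eq_of_eq_inv_mul h))
        simp [e_apply, h]
      · simp)

theorem comul_apply (f : FunctionAlgebra k G) :
    Coalgebra.comul (R := k) f = ∑ a, e k a ⊗ₜ[k] translate a f := comulLin_apply f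

theorem comul_e (s : G) :
    Coalgebra.comul (R := k) (e k s) = ∑ a, e k a ⊗ₜ[k] e k (a⁻¹ * s) := comulLin_e s

theorem counit_apply (f : FunctionAlgebra k G) : Coalgebra.counit (R := k) f = f 1 := rfl

/-- The antipode `f ↦ f (·⁻¹)`. -/
noncomputable instance : HopfAlgebra k (FunctionAlgebra k G) where
  antipode :=
    { toFun := fun f s => f s⁻¹
      map_add' := fun _ _ => rfl
      map_smul' := fun _ _ => rfl }
  mul_antipode_rTensor_comul := by
    refine LinearMap.ext fun f => ext fun t => ?_
    simp [comul_apply, sum_apply]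
    change ∑ i, e k i t⁻¹ * f (i * t) = f 1
    rw [Finset.sum_eq_single t⁻¹] <;> simp +contextual [e_apply, eq_comm]
  mul_antipode_lTensor_comul := by
    refine LinearMap.ext fun f => ext fun t => ?_
    simp [comul_apply, sum_apply]
    change ∑ i, e k i t * f (i * t⁻¹) = f 1
    rw [Finset.sum_eq_single t] <;> simp +contextual [e_apply, eq_comm]

end FunctionAlgebra

/-! ### Extensions of Hopf algebras -/

/-- An extension `k → k^G → A → kF → k` of finite-dimensional Hopf algebras: `i` is an injective
and `π` a surjective Hopf algebra map, and `i` identifies `k^G` with the algebra of coinvariants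
`A^{co kF} = {a | (id ⊗ π) (Δ a) = a ⊗ 1}`. -/
structure HopfExtension (k G F : Type u) [Field k] [Group G] [Fintype G] [Group F] where
  A : Type u
  [ring : Ring A]
  [hopf : HopfAlgebra k A]
  [finite : FiniteDimensional k A]
  i : FunctionAlgebra k G →ₐc[k] A
  π : A →ₐc[k] MonoidAlgebra k F
  i_injective : Function.Injective i
  π_surjective : Function.Surjective π
  mem_range_i : ∀ a : A, a ∈ Set.range i ↔
    (π : A →ₗ[k] MonoidAlgebra k F).lTensor A (Coalgebra.comul a) = a ⊗ₜ[k] 1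

attribute [instance] HopfExtension.ring HopfExtension.hopf HopfExtension.finite

namespace HopfExtension

variable {k G F : Type u} [Field k] [Group G] [Fintype G] [Group F]

/-- The right coaction `(id ⊗ π) ∘ Δ : A → A ⊗ kF`. -/
noncomputable def coaction (E : HopfExtension k G F) : E.A →ₗ[k] E.A ⊗[k] MonoidAlgebra k F :=
  (E.π : E.A →ₗ[k] MonoidAlgebra k F).lTensor E.A ∘ₗ Coalgebra.comul

/-- Two extensions are equivalent if there is a homomorphism of Hopf algebras between them that
commutes with the maps from `k^G` and the maps to `kF`. -/
def Equivalent (E E' : HopfExtension k G F) : Prop :=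
  ∃ f : E.A →ₐc[k] E'.A, f.comp E.i = E'.i ∧ E'.π.comp f = E.π

end HopfExtension

/-! ### Abelian extensions -/

/-- Compatible normalized 2-cocycles `σ ∈ Z²(F, (k^G)ˣ)` and `τ ∈ Z²(G, (k^F)ˣ)` for a matched
pair, written `σ s x y = σ(s; x, y)` and `τ s t x = τ(s, t; x)`. -/
structure CocyclePair (k : Type u) {G F : Type u} [Field k] [Group G] [Group F]
    (M : MatchedPair G F) where
  σ : G → F → F → kˣ
  τ : G → G → F → kˣ
  σ_cocycle : ∀ s x y z, σ (M.ract s x) y z * σ s x (y * z) = σ s x y * σ s (x * y) z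
  τ_cocycle : ∀ s t u x, τ s t (M.lact u x) * τ (s * t) u x = τ t u x * τ s (t * u) x
  σ_one_left : ∀ s x, σ s 1 x = 1
  σ_one_right : ∀ s x, σ s x 1 = 1
  σ_one : ∀ x y, σ 1 x y = 1
  τ_one_left : ∀ s x, τ 1 s x = 1
  τ_one_right : ∀ s x, τ s 1 x = 1
  τ_one : ∀ s t, τ s t 1 = 1
  compatible : ∀ s t x y,
    σ (s * t) x y * τ s t (x * y) =
      σ s (M.lact t x) (M.lact (M.ract t x) y) * σ t x y *
        (τ s t x * τ (M.ract s (M.lact t x)) (M.ract t x) y)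

open Classical in
/-- `v` exhibits the extension `E` as `k^G #_{σ,τ} kF`: it is a basis `v (s, x) = e_s # x` of the
Hopf algebra, in which the product, the coproduct and the maps `i` and `π` are given by
`(e_s # x)(e_t # y) = δ_{s ◁ x, t} σ(s; x, y) e_s # xy`,
`Δ(e_s # x) = ∑_{s = ab} τ(a, b; x) e_a # (b ▷ x) ⊗ e_b # x`,
`i(e_s) = e_s # 1` and `π(e_s # x) = δ_{s, 1} x`.
(The unit `∑ s, e_s # 1` and the counit `e_s # x ↦ δ_{s, 1}` are then forced by `i` and `π`.) -/
structure IsCrossedBasis {k G F : Type u} [Field k] [Group G] [Fintype G] [Group F]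
    {M : MatchedPair G F} (c : CocyclePair k M) (E : HopfExtension k G F)
    (v : Module.Basis (G × F) k E.A) : Prop where
  mul : ∀ s x t y, v (s, x) * v (t, y) =
    if M.ract s x = t then (c.σ s x y : k) • v (s, x * y) else 0
  comul : ∀ s x, Coalgebra.comul (R := k) (v (s, x)) =
    ∑ a : G, (c.τ a (a⁻¹ * s) x : k) •
      (v (a, M.lact (a⁻¹ * s) x) ⊗ₜ[k] v (a⁻¹ * s, x))
  i_e : ∀ s, E.i (FunctionAlgebra.e k s) = v (s, 1)
  π_v : ∀ s x, E.π (v (s, x)) = if s = 1 then MonoidAlgebra.single x 1 else 0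

/-- An abelian extension associated to the matched pair `M`: an extension of `kF` by `k^G` of the
form `k^G #_{σ,τ} kF`, for some compatible 2-cocycles `σ`, `τ`. -/
structure AbelianExtension (k : Type u) {G F : Type u} [Field k] [Group G] [Fintype G] [Group F]
    (M : MatchedPair G F) extends HopfExtension k G F where
  isCrossed : ∃ (c : CocyclePair k M) (v : Module.Basis (G × F) k A),
    IsCrossedBasis c toHopfExtension v

section Equivalence

variable {k G F : Type u} [Field k] [Group G] [Fintype G] [Group F] {M : MatchedPair G F}

theorem IsCrossedBasis.coaction {c : CocyclePair k M} {E : HopfExtension k G F}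
    {v : Module.Basis (G × F) k E.A} (h : IsCrossedBasis c E v) (s : G) (x : F) :
    E.coaction (v (s, x)) = v (s, x) ⊗ₜ[k] MonoidAlgebra.single x 1 := by
  have hπ : ∀ t y, (E.π : E.A →ₗ[k] MonoidAlgebra k F) (v (t, y)) = E.π (v (t, y)) :=
    fun _ _ => rfl
  rw [HopfExtension.coaction, LinearMap.comp_apply, h.comul, map_sum,
    Finset.sum_eq_single s]
  · simp [hπ, h.π_v, c.τ_one_right, M.one_lact]
  · intro a _ ha
    have ha' : a⁻¹ * s ≠ 1 := fun h' => ha (inv_mul_eq_one.1 h')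
    simp [hπ, h.π_v, ha']
  · simp

/-- A homomorphism of extensions sends `e_s # x` to a non-zero multiple of `e_s # x`. -/
theorem HopfExtension.exists_unit_smul {E E' : HopfExtension k G F} {c c' : CocyclePair k M}
    {v : Module.Basis (G × F) k E.A} (hv : IsCrossedBasis c E v)
    {v' : Module.Basis (G × F) k E'.A} (hv' : IsCrossedBasis c' E' v')
    (f : E.A →ₐc[k] E'.A) (hi : f.comp E.i = E'.i) (hπ : E'.π.comp f = E.π) (s : G) (x : F) :
    ∃ r : kˣ, f (v (s, x)) = (r : k) • v' (s, x) := by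
  classical
  have hfi : ∀ t, f (v (t, 1)) = v' (t, 1) := fun t => by
    rw [← hv.i_e, ← hv'.i_e, ← hi]; rfl
  have hleft : v' (s, 1) * f (v (s, x)) = f (v (s, x)) := by
    rw [← hfi, ← map_mul, hv.mul]
    simp [M.ract_one, c.σ_one_left]
  have hco : E'.coaction (f (v (s, x))) = f (v (s, x)) ⊗ₜ[k] MonoidAlgebra.single x 1 := by
    have h1 : E'.coaction ∘ₗ (f : E.A →ₗ[k] E'.A) =
        (f : E.A →ₗ[k] E'.A).rTensor _ ∘ₗ E.coaction := by
      have hf : Coalgebra.comul ∘ₗ (f : E.A →ₗ[k] E'.A) =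
          TensorProduct.map (f : E.A →ₗ[k] E'.A) (f : E.A →ₗ[k] E'.A) ∘ₗ Coalgebra.comul :=
        (CoalgHomClass.map_comp_comul (f : E.A →ₐc[k] E'.A)).symm
      have hp : (E'.π : E'.A →ₗ[k] MonoidAlgebra k F) ∘ₗ (f : E.A →ₗ[k] E'.A) =
          (E.π : E.A →ₗ[k] MonoidAlgebra k F) := by rw [← hπ]; rfl
      rw [HopfExtension.coaction, HopfExtension.coaction, LinearMap.comp_assoc, hf,
        ← LinearMap.comp_assoc, ← LinearMap.comp_assoc, LinearMap.lTensor_comp_map, hp,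
        LinearMap.rTensor_comp_lTensor]
    have h2 := LinearMap.congr_fun h1 (v (s, x))
    simpa [hv.coaction] using h2
  have hnz : f (v (s, x)) ≠ 0 := by
    intro h0
    have h1 : v (s, x) * v (M.ract s x, x⁻¹) = (c.σ s x x⁻¹ : k) • v (s, 1) := by
      rw [hv.mul, if_pos rfl, mul_inv_cancel]
    have h2 := congrArg f h1
    rw [map_mul, h0, zero_mul, map_smul, hfi] at h2
    rcases smul_eq_zero.1 h2.symm with h3 | h3
    · exact (c.σ s x x⁻¹).ne_zero h3
    · exact v'.ne_zero _ h3
  have hcoord : ∀ p : G × F, p ≠ (s, x) → v'.repr (f (v (s, x))) p = 0 := by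
    rintro ⟨t, y⟩ hp
    by_cases hts : t = s
    · subst hts
      have hyx : y ≠ x := fun h => hp (by rw [h])
      have h1 : (TensorProduct.rid k k).toLinearMap ∘ₗ
          TensorProduct.map (v'.coord (t, y))
            (Finsupp.lapply x ∘ₗ (MonoidAlgebra.coeffLinearEquiv k).toLinearMap) ∘ₗ
            E'.coaction = 0 := by
        refine v'.ext ?_
        rintro ⟨t', y'⟩
        by_cases h : y' = x
        · subst h
          simp [hv'.coaction, hyx.symm]
        · simp [hv'.coaction, Finsupp.single_apply, h]
      have h2 := LinearMap.congr_fun h1 (f (v (t, x)))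
      simpa [hco] using h2
    · have h1 : v'.coord (t, y) ∘ₗ LinearMap.mulLeft k (v' (s, 1)) = 0 := by
        refine v'.ext ?_
        rintro ⟨t', y'⟩
        by_cases h : s = t'
        · subst h
          simp [hv'.mul, M.ract_one, Ne.symm hts]
        · simp [hv'.mul, M.ract_one, h]
      have h2 := LinearMap.congr_fun h1 (f (v (s, x)))
      simpa [hleft] using h2
  have hrepr : v'.repr (f (v (s, x))) =
      Finsupp.single (s, x) (v'.repr (f (v (s, x))) (s, x)) := by
    ext p
    by_cases hp : p = (s, x)
    · subst hp; simp
    · rw [hcoord p hp, Finsupp.single_eq_of_ne hp]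
  have hsmul : f (v (s, x)) = v'.repr (f (v (s, x))) (s, x) • v' (s, x) := by
    apply v'.repr.injective
    rw [map_smul, v'.repr_self, Finsupp.smul_single, smul_eq_mul, mul_one]
    exact hrepr
  have hr : v'.repr (f (v (s, x))) (s, x) ≠ 0 := fun h0 => hnz (by rw [hsmul, h0, zero_smul])
  exact ⟨Units.mk0 _ hr, hsmul⟩

theorem HopfExtension.bijective_of_equivalence {E E' : HopfExtension k G F}
    {c c' : CocyclePair k M}
    {v : Module.Basis (G × F) k E.A} (hv : IsCrossedBasis c E v)
    {v' : Module.Basis (G × F) k E'.A} (hv' : IsCrossedBasis c' E' v')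
    (f : E.A →ₐc[k] E'.A) (hi : f.comp E.i = E'.i) (hπ : E'.π.comp f = E.π) :
    Function.Bijective f := by
  choose r hr using fun p : G × F => HopfExtension.exists_unit_smul hv hv' f hi hπ p.1 p.2
  have h : (f : E.A →ₗ[k] E'.A) =
      (v.equiv (v'.unitsSMul r) (Equiv.refl _)).toLinearMap := by
    refine v.ext fun p => ?_
    have h1 : (f : E.A →ₗ[k] E'.A) (v p) = f (v p) := rfl
    rw [h1, hr p]
    simp [Module.Basis.unitsSMul_apply, Units.smul_def]
  have h2 : (f : E.A → E'.A) = v.equiv (v'.unitsSMul r) (Equiv.refl _) := by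
    funext a
    exact LinearMap.congr_fun h a
  rw [h2]
  exact LinearEquiv.bijective _

end Equivalence

namespace AbelianExtension

variable {k G F : Type u} [Field k] [Group G] [Fintype G] [Group F] {M : MatchedPair G F}

/-- Equivalence of extensions, restricted to the abelian extensions associated to `M`. -/
instance setoid (k : Type u) {G F : Type u} [Field k] [Group G] [Fintype G] [Group F]
    (M : MatchedPair G F) : Setoid (AbelianExtension k M) where
  r E E' := E.toHopfExtension.Equivalent E'.toHopfExtension
  iseqv :=
    { refl := fun E => ⟨BialgHom.id k E.A, by ext; rfl, by ext; rfl⟩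
      symm := by
        rintro E E' ⟨f, hi, hπ⟩
        obtain ⟨c, v, hv⟩ := E.isCrossed
        obtain ⟨c', v', hv'⟩ := E'.isCrossed
        let g := BialgEquiv.ofBijective f
          (HopfExtension.bijective_of_equivalence hv hv' f hi hπ)
        refine ⟨(g.symm : E'.A →ₐc[k] E.A), ?_, ?_⟩
        · refine BialgHom.ext fun a => ?_
          rw [← hi]
          exact g.symm_apply_apply (E.i a)
        · refine BialgHom.ext fun a => ?_
          rw [← hπ]
          exact congrArg E'.π (g.apply_symm_apply a)
      trans := by
        rintro E E' E'' ⟨f, hi, hπ⟩ ⟨g, hi', hπ'⟩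
        refine ⟨g.comp f, ?_, ?_⟩
        · rw [BialgHom.comp_assoc, hi, hi']
        · rw [← BialgHom.comp_assoc, hπ', hπ] }

end AbelianExtension

/-- `Opext_{▷,◁}(kF, k^G)`: the set of equivalence classes of abelian extensions associated to a
matched pair. -/
def Opext (k : Type u) {G F : Type u} [Field k] [Group G] [Fintype G] [Group F]
    (M : MatchedPair G F) : Type (u + 1) :=
  Quotient (AbelianExtension.setoid k M)

/-- The class of an abelian extension in `Opext`. -/
def AbelianExtension.toOpext {k G F : Type u} [Field k] [Group G] [Fintype G] [Group F]
    {M : MatchedPair G F} (E : AbelianExtension k M) : Opext k M :=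
  Quotient.mk _ E

/-! ### The Baer product -/

namespace HopfExtension

variable {k G F : Type u} [Field k] [Group G] [Fintype G] [Group F]

/-- The cotensor part `A₁ □ A₂` of `A₁ ⊗ A₂`: the elements on which the right `kF`-coactions of
the two factors, `a ⊗ b ↦ a ⊗ b₍₀₎ ⊗ b₍₁₎` and `a ⊗ b ↦ a₍₀₎ ⊗ b ⊗ a₍₁₎`, agree. -/
noncomputable def cotensor (E₁ E₂ : HopfExtension k G F) : Submodule k (E₁.A ⊗[k] E₂.A) :=
  LinearMap.eqLocus
    ((TensorProduct.assoc k E₁.A E₂.A (MonoidAlgebra k F)).symm.toLinearMap ∘ₗ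
      E₂.coaction.lTensor E₁.A)
    ((TensorProduct.rightComm k E₁.A (MonoidAlgebra k F) E₂.A).toLinearMap ∘ₗ
      E₁.coaction.rTensor E₂.A)

/-- The kernel of `A₁ ⊗ A₂ → A₁ ⊗_{k^G} A₂`, where `k^G` acts on both factors by left
multiplication. -/
def balancing (E₁ E₂ : HopfExtension k G F) : Submodule k (E₁.A ⊗[k] E₂.A) :=
  Submodule.span k
    {t | ∃ (f : FunctionAlgebra k G) (a : E₁.A) (b : E₂.A),
      t = (E₁.i f * a) ⊗ₜ[k] b - a ⊗ₜ[k] (E₂.i f * b)}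

/-- The tensor product `A₁ ⊗_{k^G} A₂`. -/
abbrev BalancedTensor (E₁ E₂ : HopfExtension k G F) : Type u :=
  (E₁.A ⊗[k] E₂.A) ⧸ E₁.balancing E₂

/-- `E` is a Baer product of the extensions `E₁` and `E₂`: its Hopf algebra `A` is, through the
linear embedding `j`, the image of the cotensor product `A₁ □ A₂` in `A₁ ⊗_{k^G} A₂`. Its product
is induced by the product of the subalgebra `A₁ □ A₂ ⊆ A₁ ⊗ A₂` and its coproduct by the coproduct
of the quotient coalgebra `A₁ ⊗ A₂ → A₁ ⊗_{k^G} A₂`; the map from `k^G` is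
`f ↦ i₁(f) ⊗ 1 = 1 ⊗ i₂(f)` and the map to `kF` is induced by `π₁ ⊗ ε = ε ⊗ π₂`. -/
def IsBaerProduct (E₁ E₂ E : HopfExtension k G F) : Prop :=
  ∃ j : E.A →ₗ[k] E₁.BalancedTensor E₂,
    Function.Injective j ∧
    LinearMap.range j = (E₁.cotensor E₂).map (E₁.balancing E₂).mkQ ∧
    (∀ a b : E.A, ∀ s ∈ E₁.cotensor E₂, ∀ t ∈ E₁.cotensor E₂,
      j a = (E₁.balancing E₂).mkQ s → j b = (E₁.balancing E₂).mkQ t →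
        j (a * b) = (E₁.balancing E₂).mkQ (s * t)) ∧
    (∀ a : E.A, ∀ t ∈ E₁.cotensor E₂, j a = (E₁.balancing E₂).mkQ t →
      TensorProduct.map j j (Coalgebra.comul a) =
        TensorProduct.map (E₁.balancing E₂).mkQ (E₁.balancing E₂).mkQ
          (Coalgebra.comul (R := k) t)) ∧
    (∀ f : FunctionAlgebra k G,
      j (E.i f) = (E₁.balancing E₂).mkQ (E₁.i f ⊗ₜ[k] 1)) ∧
    (∀ a : E.A, ∀ t ∈ E₁.cotensor E₂, j a = (E₁.balancing E₂).mkQ t →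
      E.π a = TensorProduct.rid k (MonoidAlgebra k F)
        (TensorProduct.map (E₁.π : E₁.A →ₗ[k] MonoidAlgebra k F)
          (Coalgebra.counit : E₂.A →ₗ[k] k) t))

end HopfExtension

/-! Both sides of the isomorphism are the group of compatible pairs (σ, τ) modulo coboundaries of
normalized cochains ν.

Hopf side. In an abelian extension the line through e_s # x consists of the elements fixed by left
multiplication by e_s and of degree x for the kF-coaction. A map of extensions is therefore diagonal
in the crossed bases, and comparing products and coproducts shows that its diagonal entries exhibit
the quotient of the two cocycle pairs as a coboundary (`div_mem_coboundaries`). Conversely,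
rescaling a basis realizes every coboundary (`rescale`), and every pair comes from a crossed
product, whose antipode is explicit. Hence Opext is the set of cocycle classes
(`equivCocycleClass`). The Baer product has the vectors (e_s # x) ⊗ (e_s # x) as a basis, and their
structure constants are the products of those of the factors, so it multiplies classes
(`isBaerProduct_iff`).

Homological side. Regard X as the vertex set of the complete bipartite graph with parts F and G.
Since Σ is exactly factorized by F and G, it permutes the edges F × G simply transitively
(`toBowtie_act`), so the modules of edges and of squares [x, y] ⊗ [s, t] are projective. The graph
is connected, so edges map onto Λ_X by (x, s) ↦ x - s, and its cycles are generated by the squares;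
both facts come from coning off the base points 1 (`isFourTermExact`). With Z the kernel of the map
from squares to edges, dimension shifting identifies Ext² with the invariant homomorphisms Z → kˣ
modulo those extending to all squares (`extTwo_surjective`, `extTwo_eq_zero_iff`).

Z is generated by the boundaries of (2,1)- and (1,2)-chains (`syzygy_induction`). The values of an
invariant homomorphism on these, moved to the base edge, are σ and τ⁻¹. The relation ∂∂ = 0 on
(3,1)-, (1,3)- and (2,2)-chains gives the two cocycle identities and the compatibility. Conversely a
pair has a potential on squares which need not be invariant, but whose restriction to Z is
(`potentialHom_smul`). Homomorphisms that extend to squares correspond to coboundaries, ν being the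
value on a square at the base edge (`cocycleOfHom_mem_coboundaries_iff`). -/

/-! ### The group of compatible pairs of cocycles -/

namespace CocyclePair

variable {k G F : Type u} [Field k] [Group G] [Group F] {M : MatchedPair G F}

theorem ext' {c d : CocyclePair k M} (hσ : ∀ s x y, c.σ s x y = d.σ s x y)
    (hτ : ∀ s t x, c.τ s t x = d.τ s t x) : c = d := by
  cases c
  cases d
  congr
  · funext s x y
    exact hσ s x y
  · funext s t x
    exact hτ s t x

instance : One (CocyclePair k M) :=
  ⟨{ σ := fun _ _ _ => 1
     τ := fun _ _ _ => 1
     σ_cocycle := fun _ _ _ _ => rfl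
     τ_cocycle := fun _ _ _ _ => rfl
     σ_one_left := fun _ _ => rfl
     σ_one_right := fun _ _ => rfl
     σ_one := fun _ _ => rfl
     τ_one_left := fun _ _ => rfl
     τ_one_right := fun _ _ => rfl
     τ_one := fun _ _ => rfl
     compatible := fun _ _ _ _ => by simp }⟩

instance : Mul (CocyclePair k M) :=
  ⟨fun c d =>
   { σ := fun s x y => c.σ s x y * d.σ s x y
     τ := fun s t x => c.τ s t x * d.τ s t x
     σ_cocycle := fun s x y z => by
       rw [mul_mul_mul_comm, c.σ_cocycle, d.σ_cocycle, mul_mul_mul_comm]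
     τ_cocycle := fun s t u x => by
       rw [mul_mul_mul_comm, c.τ_cocycle, d.τ_cocycle, mul_mul_mul_comm]
     σ_one_left := fun s x => by rw [c.σ_one_left, d.σ_one_left, one_mul]
     σ_one_right := fun s x => by rw [c.σ_one_right, d.σ_one_right, one_mul]
     σ_one := fun x y => by rw [c.σ_one, d.σ_one, one_mul]
     τ_one_left := fun s x => by rw [c.τ_one_left, d.τ_one_left, one_mul]
     τ_one_right := fun s x => by rw [c.τ_one_right, d.τ_one_right, one_mul]
     τ_one := fun s t => by rw [c.τ_one, d.τ_one, one_mul]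
     compatible := fun s t x y => by
       rw [mul_mul_mul_comm, c.compatible, d.compatible]
       simp only [mul_assoc, mul_left_comm, mul_comm] }⟩

instance : Inv (CocyclePair k M) :=
  ⟨fun c =>
   { σ := fun s x y => (c.σ s x y)⁻¹
     τ := fun s t x => (c.τ s t x)⁻¹
     σ_cocycle := fun s x y z => by rw [← mul_inv, c.σ_cocycle, mul_inv]
     τ_cocycle := fun s t u x => by rw [← mul_inv, c.τ_cocycle, mul_inv]
     σ_one_left := fun s x => by rw [c.σ_one_left, inv_one]
     σ_one_right := fun s x => by rw [c.σ_one_right, inv_one]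
     σ_one := fun x y => by rw [c.σ_one, inv_one]
     τ_one_left := fun s x => by rw [c.τ_one_left, inv_one]
     τ_one_right := fun s x => by rw [c.τ_one_right, inv_one]
     τ_one := fun s t => by rw [c.τ_one, inv_one]
     compatible := fun s t x y => by simp only [← mul_inv, c.compatible] }⟩

@[simp] theorem one_σ (s : G) (x y : F) : (1 : CocyclePair k M).σ s x y = 1 := rfl
@[simp] theorem one_τ (s t : G) (x : F) : (1 : CocyclePair k M).τ s t x = 1 := rfl
@[simp] theorem mul_σ (c d : CocyclePair k M) (s : G) (x y : F) :
    (c * d).σ s x y = c.σ s x y * d.σ s x y := rfl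
@[simp] theorem mul_τ (c d : CocyclePair k M) (s t : G) (x : F) :
    (c * d).τ s t x = c.τ s t x * d.τ s t x := rfl
@[simp] theorem inv_σ (c : CocyclePair k M) (s : G) (x y : F) :
    (c⁻¹).σ s x y = (c.σ s x y)⁻¹ := rfl
@[simp] theorem inv_τ (c : CocyclePair k M) (s t : G) (x : F) :
    (c⁻¹).τ s t x = (c.τ s t x)⁻¹ := rfl

instance : CommGroup (CocyclePair k M) :=
  { Group.ofLeftAxioms (G := CocyclePair k M)
      (fun _ _ _ => ext' (fun _ _ _ => mul_assoc _ _ _) (fun _ _ _ => mul_assoc _ _ _))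
      (fun _ => ext' (fun _ _ _ => one_mul _) (fun _ _ _ => one_mul _))
      (fun _ => ext' (fun _ _ _ => inv_mul_cancel _) (fun _ _ _ => inv_mul_cancel _)) with
    mul_comm := fun _ _ => ext' (fun _ _ _ => mul_comm _ _) (fun _ _ _ => mul_comm _ _) }

/-- The pair `c` is the coboundary of the normalized cochain `ν`. -/
structure IsCoboundaryOf (c : CocyclePair k M) (ν : G → F → kˣ) : Prop where
  one_left : ∀ x, ν 1 x = 1
  one_right : ∀ s, ν s 1 = 1
  σ_eq : ∀ s x y, c.σ s x y = ν s x * ν (M.ract s x) y / ν s (x * y)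
  τ_eq : ∀ s t x, c.τ s t x = ν (s * t) x / (ν s (M.lact t x) * ν t x)

variable (k M) in
/-- The subgroup of coboundaries of normalized cochains. -/
def coboundaries : Subgroup (CocyclePair k M) where
  carrier := {c | ∃ ν, c.IsCoboundaryOf ν}
  one_mem' := ⟨fun _ _ => 1, fun _ => rfl, fun _ => rfl, fun _ _ _ => by simp,
    fun _ _ _ => by simp⟩
  mul_mem' := by
    rintro c d ⟨ν, h⟩ ⟨μ, h'⟩
    refine ⟨fun s x => ν s x * μ s x, fun x => ?_, fun s => ?_, fun s x y => ?_, fun s t x => ?_⟩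
    · rw [h.one_left, h'.one_left, one_mul]
    · rw [h.one_right, h'.one_right, one_mul]
    · rw [mul_σ, h.σ_eq, h'.σ_eq, div_mul_div_comm, mul_mul_mul_comm]
    · rw [mul_τ, h.τ_eq, h'.τ_eq, div_mul_div_comm, mul_mul_mul_comm (ν s _)]
  inv_mem' := by
    rintro c ⟨ν, h⟩
    refine ⟨fun s x => (ν s x)⁻¹, fun x => ?_, fun s => ?_, fun s x y => ?_, fun s t x => ?_⟩
    · rw [h.one_left, inv_one]
    · rw [h.one_right, inv_one]
    · rw [inv_σ, h.σ_eq, inv_div, ← mul_inv, inv_div_inv]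
    · rw [inv_τ, h.τ_eq, inv_div, ← mul_inv, inv_div_inv]

end CocyclePair

/-! ### Homogeneous cochains of a matched pair -/

namespace MatchedPair

variable {G F : Type u} [Group G] [Group F] (M : MatchedPair G F)

/-- The action of `Σ` on `F = Σ/G`. -/
def actF (p : M.Bowtie) (x : F) : F := p.fst * M.lact p.snd x

/-- The left action of `Σ` on `G = F\Σ`. -/
def actG (p : M.Bowtie) (s : G) : G := M.ract s p⁻¹.fst * p⁻¹.snd

theorem one_actF (x : F) : M.actF 1 x = x := by
  simp [actF, M.one_lact]

theorem mul_actF (p q : M.Bowtie) (x : F) : M.actF (p * q) x = M.actF p (M.actF q x) := by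
  simp [actF, M.lact_mul, M.mul_lact, mul_assoc]

theorem one_actG (s : G) : M.actG 1 s = s := by
  rw [actG, inv_one, Bowtie.fst_one, Bowtie.snd_one, M.ract_one, mul_one]

theorem mul_actG (p q : M.Bowtie) (s : G) : M.actG (p * q) s = M.actG p (M.actG q s) := by
  rw [actG, actG, actG, mul_inv_rev, Bowtie.fst_mul, Bowtie.snd_mul, M.mul_ract, M.ract_mul,
    mul_assoc]

theorem inv_actF_actF (p : M.Bowtie) (x : F) : M.actF p⁻¹ (M.actF p x) = x := by
  rw [← mul_actF, inv_mul_cancel, one_actF]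

theorem inv_actG_actG (p : M.Bowtie) (s : G) : M.actG p⁻¹ (M.actG p s) = s := by
  rw [← mul_actG, inv_mul_cancel, one_actG]

theorem actF_injective (p : M.Bowtie) : Function.Injective (M.actF p) :=
  Function.LeftInverse.injective (M.inv_actF_actF p)

theorem actG_injective (p : M.Bowtie) : Function.Injective (M.actG p) :=
  Function.LeftInverse.injective (M.inv_actG_actG p)

theorem ract_inv (s : G) (x : F) : (M.ract s x)⁻¹ = M.ract s⁻¹ (M.lact s x) := by
  have h := M.mul_ract s⁻¹ s x
  rw [inv_mul_cancel, M.one_ract] at h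
  exact (eq_inv_of_mul_eq_one_left h.symm).symm

theorem lact_inv (s : G) (x : F) : (M.lact s x)⁻¹ = M.lact (M.ract s x) x⁻¹ := by
  have h := M.lact_mul s x x⁻¹
  rw [mul_inv_cancel, M.lact_one] at h
  exact (eq_inv_of_mul_eq_one_right h.symm).symm

theorem lact_inv_lact (s : G) (x : F) : M.lact s⁻¹ (M.lact s x) = x := by
  rw [← M.mul_lact, inv_mul_cancel, M.one_lact]

theorem lact_lact_inv (s : G) (x : F) : M.lact s (M.lact s⁻¹ x) = x := by
  rw [← M.mul_lact, mul_inv_cancel, M.one_lact]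

theorem ract_ract_inv (s : G) (x : F) : M.ract (M.ract s x) x⁻¹ = s := by
  rw [← M.ract_mul, mul_inv_cancel, M.ract_one]

theorem ract_inv_ract (s : G) (x : F) : M.ract (M.ract s x⁻¹) x = s := by
  rw [← M.ract_mul, inv_mul_cancel, M.ract_one]

/-- The right factor produced by `p` does not depend on `s`, so it cancels in (s ◁ x)(t ◁ x)⁻¹. This
is why `diffG` is Σ-invariant. -/
theorem ract_act (p : M.Bowtie) (x : F) (s : G) :
    M.ract (M.actG p s) (M.actF p x) = M.ract s x * (M.ract p.snd x)⁻¹ := by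
  have h : p⁻¹.fst * M.lact p⁻¹.snd (M.actF p x) = x := M.inv_actF_actF p x
  rw [actG, M.mul_ract, ← M.ract_mul, h, M.ract_inv p.snd x, Bowtie.snd_inv, ← M.ract_mul, actF,
    inv_mul_cancel_left]

/-- Here the extra left factor does not depend on `x` and cancels in (s ▷ x)⁻¹(s ▷ y), which makes
`diffF` invariant. -/
theorem lact_act (p : M.Bowtie) (x : F) (s : G) :
    M.lact (M.actG p s) (M.actF p x) = (M.lact s p⁻¹.fst)⁻¹ * M.lact s x := by
  have h := M.lact_mul s p⁻¹.fst (M.lact p⁻¹.snd (M.actF p x))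
  have h' : p⁻¹.fst * M.lact p⁻¹.snd (M.actF p x) = x := M.inv_actF_actF p x
  rw [h'] at h
  rw [h, inv_mul_cancel_left, ← M.mul_lact, actG]

/-! ### Invariant differences and the torsor F × G -/

/-- The difference `(s ◁ x) (t ◁ x)⁻¹` of two points of `G`, seen from `x`. -/
def diffG (x : F) (s t : G) : G := M.ract s x * (M.ract t x)⁻¹

/-- The difference `(t ▷ x)⁻¹ (t ▷ y)` of two points of `F`, seen from `t`. -/
def diffF (x y : F) (t : G) : F := (M.lact t x)⁻¹ * M.lact t y

theorem diffG_mul (x : F) (s t u : G) : M.diffG x s t * M.diffG x t u = M.diffG x s u := by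
  simp [diffG]

theorem diffF_mul (x y z : F) (t : G) : M.diffF x y t * M.diffF y z t = M.diffF x z t := by
  simp [diffF, mul_assoc]

@[simp] theorem diffG_self (x : F) (s : G) : M.diffG x s s = 1 := mul_inv_cancel _

@[simp] theorem diffF_self (x : F) (t : G) : M.diffF x x t = 1 := inv_mul_cancel _

theorem diffG_eq (x : F) (s t : G) : M.diffG x s t = M.ract (s * t⁻¹) (M.lact t x) := by
  rw [diffG, M.ract_inv, M.mul_ract, M.lact_inv_lact]

theorem diffF_eq (x y : F) (t : G) : M.diffF x y t = M.lact (M.ract t x) (x⁻¹ * y) := by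
  rw [diffF, M.lact_inv, M.lact_mul, M.ract_ract_inv]

/-- The two actions carry one side of the square on x, y, s, t to the opposite side; `lact_diffF` is
the other half. Because of this, substituting differences into the inhomogeneous cocycle identities
yields the homogeneous ones directly. -/
theorem ract_diffG (x y : F) (s t : G) :
    M.ract (M.diffG x s t) (M.diffF x y t) = M.diffG y s t := by
  rw [diffG_eq, ← M.ract_mul, diffF, mul_inv_cancel_left, ← diffG_eq]

theorem lact_diffF (x y : F) (s t : G) :
    M.lact (M.diffG x s t) (M.diffF x y t) = M.diffF x y s := by
  rw [diffF_eq, ← M.mul_lact, diffG, inv_mul_cancel_right, ← diffF_eq]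

theorem diffG_act (p : M.Bowtie) (x : F) (s t : G) :
    M.diffG (M.actF p x) (M.actG p s) (M.actG p t) = M.diffG x s t := by
  simp [diffG, ract_act]

theorem diffF_act (p : M.Bowtie) (x y : F) (t : G) :
    M.diffF (M.actF p x) (M.actF p y) (M.actG p t) = M.diffF x y t := by
  simp [diffF, lact_act, mul_assoc]

@[simp] theorem diffG_one (s : G) : M.diffG 1 s 1 = s := by
  simp [diffG, M.ract_one]

@[simp] theorem diffF_one (x : F) : M.diffF 1 x 1 = x := by
  simp [diffF, M.one_lact]

@[simp] theorem diffF_one_left (x : F) (t : G) : M.diffF 1 x t = M.lact t x := by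
  simp [diffF, M.lact_one]

@[simp] theorem diffG_one_right (x : F) (s : G) : M.diffG x s 1 = M.ract s x := by
  simp [diffG, M.one_ract]

@[simp] theorem diffG_one_left (s t : G) : M.diffG 1 s t = s * t⁻¹ := by
  simp [diffG, M.ract_one]

@[simp] theorem diffF_one_right (x y : F) : M.diffF x y 1 = x⁻¹ * y := by
  simp [diffF, M.one_lact]

/-- The element of `Σ` that moves the base point of `F × G` to `(x, s)`. -/
def toBowtie (x : F) (s : G) : M.Bowtie := ⟨x, (M.ract s x)⁻¹⟩

/-- This equivariance makes F × G, and every Σ-set mapping to it, free over Σ; projectivity of the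
two terms of the resolution rests on it. -/
theorem toBowtie_act (p : M.Bowtie) (x : F) (s : G) :
    M.toBowtie (M.actF p x) (M.actG p s) = p * M.toBowtie x s := by
  refine Bowtie.ext rfl ?_
  change (M.ract (M.actG p s) (M.actF p x))⁻¹ = M.ract p.snd x * (M.ract s x)⁻¹
  rw [ract_act, mul_inv_rev, inv_inv]

/-- With `toBowtie_actG` and the two base point versions below, every configuration of points is a
translate of one containing the base edge, its other points being differences. -/
theorem toBowtie_actF (x y : F) (t : G) : M.actF (M.toBowtie x t) (M.diffF x y t) = y := by
  rw [diffF_eq]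
  change x * M.lact (M.ract t x)⁻¹ _ = y
  rw [M.lact_inv_lact, mul_inv_cancel_left]

theorem toBowtie_actG (x : F) (s t : G) : M.actG (M.toBowtie x t) (M.diffG x s t) = s := by
  rw [diffG_eq]
  change M.ract _ (M.lact (M.ract t x)⁻¹⁻¹ x⁻¹) * M.ract (M.ract t x)⁻¹⁻¹ x⁻¹ = s
  rw [inv_inv, M.ract_ract_inv, ← M.ract_mul, ← M.lact_inv, mul_inv_cancel, M.ract_one,
    inv_mul_cancel_right]

theorem toBowtie_actF_one (x : F) (t : G) : M.actF (M.toBowtie x t) 1 = x := by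
  simpa using M.toBowtie_actF x x t

theorem toBowtie_actG_one (x : F) (t : G) : M.actG (M.toBowtie x t) 1 = t := by
  simpa using M.toBowtie_actG x t t

end MatchedPair

namespace CocyclePair

variable {k G F : Type u} [Field k] [Group G] [Group F] {M : MatchedPair G F}
  (c : CocyclePair k M)

/-- The homogeneous form of `σ`. -/
def homσ (x y z : F) (s t : G) : kˣ := c.σ (M.diffG x s t) (M.diffF x y t) (M.diffF y z t)

/-- The homogeneous form of `τ`. -/
def homτ (x y : F) (s t u : G) : kˣ := c.τ (M.diffG x s t) (M.diffG x t u) (M.diffF x y u)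

theorem homσ_cocycle (x y z w : F) (s t : G) :
    c.homσ y z w s t * c.homσ x y w s t = c.homσ x y z s t * c.homσ x z w s t := by
  have h := c.σ_cocycle (M.diffG x s t) (M.diffF x y t) (M.diffF y z t) (M.diffF z w t)
  simpa only [homσ, M.ract_diffG, M.diffF_mul] using h

theorem homτ_cocycle (x y : F) (s t u v : G) :
    c.homτ x y s t u * c.homτ x y s u v = c.homτ x y t u v * c.homτ x y s t v := by
  have h := c.τ_cocycle (M.diffG x s t) (M.diffG x t u) (M.diffG x u v) (M.diffF x y v)
  simpa only [homτ, M.lact_diffF, M.diffG_mul] using h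

theorem hom_compatible (x y z : F) (s t u : G) :
    c.homσ x y z s u * c.homτ x z s t u =
      c.homσ x y z s t * c.homσ x y z t u * (c.homτ x y s t u * c.homτ y z s t u) := by
  have h := c.compatible (M.diffG x s t) (M.diffG x t u) (M.diffF x y u) (M.diffF y z u)
  simpa only [homσ, homτ, M.lact_diffF, M.ract_diffG, M.diffG_mul, M.diffF_mul] using h

@[simp] theorem homσ_right (x z : F) (s t : G) : c.homσ x z z s t = 1 := by
  simp [homσ, c.σ_one_right]

@[simp] theorem homσ_self (x y z : F) (s : G) : c.homσ x y z s s = 1 := by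
  simp [homσ, c.σ_one]

@[simp] theorem homτ_right (x y : F) (s u : G) : c.homτ x y s u u = 1 := by
  simp [homτ, c.τ_one_right]

theorem homσ_act (p : M.Bowtie) (x y z : F) (s t : G) :
    c.homσ (M.actF p x) (M.actF p y) (M.actF p z) (M.actG p s) (M.actG p t) =
      c.homσ x y z s t := by
  simp [homσ, M.diffG_act, M.diffF_act]

theorem homτ_act (p : M.Bowtie) (x y : F) (s t u : G) :
    c.homτ (M.actF p x) (M.actF p y) (M.actG p s) (M.actG p t) (M.actG p u) =
      c.homτ x y s t u := by
  simp [homτ, M.diffG_act, M.diffF_act]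

theorem homσ_one (s : G) (x y : F) : c.homσ 1 x (x * y) s 1 = c.σ s x y := by
  simp [homσ, M.ract_one]

theorem homτ_one (s t : G) (x : F) : c.homτ 1 x (s * t) t 1 = c.τ s t x := by
  simp [homτ, M.ract_one]

/-- A (not equivariant) cochain whose coboundary is the pair of homogeneous cochains. -/
def potential (x y : F) (s t : G) : kˣ :=
  c.homσ 1 x y s t / c.homτ 1 y 1 s t * c.homτ 1 x 1 s t

@[simp] theorem potential_self_left (x : F) (s t : G) : c.potential x x s t = 1 := by
  simp [potential]

@[simp] theorem potential_self_right (x y : F) (s : G) : c.potential x y s s = 1 := by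
  simp [potential]

/-- The τ-factors telescope in x, y, z; what remains is the σ-identity for a tetrahedron with first
vertex 1. -/
theorem potential_F (x y z : F) (s t : G) :
    c.potential y z s t * c.potential x y s t / c.potential x z s t = c.homσ x y z s t := by
  have h := congrArg Additive.ofMul (c.homσ_cocycle 1 x y z s t)
  apply Additive.ofMul.injective
  simp only [potential, ofMul_mul, ofMul_div] at h ⊢
  linear_combination (norm := abel) -h

/-- Compatibility for the triangle 1, x, y produces τ-terms at x and at y, and the τ-cocycle
identity with first vertex 1 in G absorbs each of them into the potential. -/
theorem potential_G (x y : F) (s t u : G) :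
    c.potential x y t u * c.potential x y s t / c.potential x y s u = (c.homτ x y s t u)⁻¹ := by
  have h := congrArg Additive.ofMul (c.hom_compatible 1 x y s t u)
  have h1 := congrArg Additive.ofMul (c.homτ_cocycle 1 x 1 s t u)
  have h2 := congrArg Additive.ofMul (c.homτ_cocycle 1 y 1 s t u)
  apply Additive.ofMul.injective
  simp only [potential, ofMul_mul, ofMul_div, ofMul_inv] at h h1 h2 ⊢
  linear_combination (norm := abel) -h + h1 - h2

end CocyclePair

/-! ### Dimension shifting -/

section DimensionShift

open CategoryTheory Abelian

section General

variable {C : Type*} [Category* C] [Abelian C] [HasExt.{u} C]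

/-- The obstruction is the image in the positive-degree Ext of the projective middle term, which
vanishes. -/
theorem CategoryTheory.ShortComplex.ShortExact.extClass_comp_surjective {S : ShortComplex C}
    (hS : S.ShortExact) [Projective S.X₂] (Y : C) {n m : ℕ} (h : 1 + n = m) (x : Ext S.X₃ Y m) :
    ∃ y : Ext S.X₁ Y n, hS.extClass.comp y h = x := by
  obtain rfl : m = n + 1 := by lia
  exact Ext.contravariant_sequence_exact₃ hS Y x (Ext.eq_zero_of_projective _) h

/-- The connecting map is injective from positive degrees on; in degree zero its kernel is the maps
extending to the middle term, treated in the next lemma. -/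
theorem CategoryTheory.ShortComplex.ShortExact.extClass_comp_eq_zero {S : ShortComplex C}
    (hS : S.ShortExact) [Projective S.X₂] (Y : C) {n m : ℕ} (h : 1 + (n + 1) = m)
    {y : Ext S.X₁ Y (n + 1)} (hy : hS.extClass.comp y h = 0) : y = 0 := by
  obtain ⟨z, rfl⟩ := Ext.contravariant_sequence_exact₁ hS Y y h hy
  rw [z.eq_zero_of_projective, Ext.comp_zero]

theorem CategoryTheory.ShortComplex.ShortExact.extClass_comp_mk₀_eq_zero {S : ShortComplex C}
    (hS : S.ShortExact) {Y : C} {y : S.X₁ ⟶ Y}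
    (hy : hS.extClass.comp (Ext.mk₀ y) (add_zero 1) = 0) : ∃ z : S.X₂ ⟶ Y, S.f ≫ z = y := by
  obtain ⟨z, hz⟩ := Ext.contravariant_sequence_exact₁ hS Y (Ext.mk₀ y) (add_zero 1) hy
  obtain ⟨z, rfl⟩ := (Ext.mk₀_bijective _ _).2 z
  rw [Ext.mk₀_comp_mk₀] at hz
  exact ⟨z, (Ext.mk₀_bijective _ _).1 hz⟩

end General

variable {R : Type u} [Ring R] {K P T L A : Type u} [AddCommGroup K] [Module R K]
  [AddCommGroup P] [Module R P] [AddCommGroup T] [Module R T] [AddCommGroup L] [Module R L]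
  [AddCommGroup A] [Module R A]

/-- An exact sequence `0 → K → P → T → L → 0`. -/
structure IsFourTermExact (ι : K →ₗ[R] P) (g : P →ₗ[R] T) (f : T →ₗ[R] L) : Prop where
  injective : Function.Injective ι
  exact_left : Function.Exact ι g
  exact_right : Function.Exact g f
  surjective : Function.Surjective f

variable {ι : K →ₗ[R] P} {g : P →ₗ[R] T} {f : T →ₗ[R] L}

namespace IsFourTermExact

/-- The left half of a four term exact sequence. -/
abbrev leftHalf (h : IsFourTermExact ι g f) : ShortComplex (ModuleCat.{u} R) where
  f := ModuleCat.ofHom ι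
  g := ModuleCat.ofHom (g.codRestrict (LinearMap.ker f) h.exact_right.apply_apply_eq_zero)
  zero := by
    refine ModuleCat.hom_ext (LinearMap.ext fun x => ?_)
    exact Subtype.ext (h.exact_left.apply_apply_eq_zero x)

theorem shortExact_leftHalf (h : IsFourTermExact ι g f) : h.leftHalf.ShortExact := by
  refine ModuleCat.shortComplex_shortExact _ (fun p => ?_) h.injective ?_
  · exact Iff.trans ⟨fun e => congrArg Subtype.val e, fun e => Subtype.ext e⟩ (h.exact_left p)
  · rintro ⟨t, ht⟩
    obtain ⟨p, hp⟩ := (h.exact_right t).1 ht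
    exact ⟨p, Subtype.ext hp⟩

variable (A) in
/-- The twofold connecting homomorphism of the exact sequence `0 → K → P → T → L → 0`. -/
noncomputable def extTwo (h : IsFourTermExact ι g f) :
    (K →ₗ[R] A) →+ Ext.{u} (ModuleCat.of R L) (ModuleCat.of R A) 2 where
  toFun φ := (LinearMap.shortExact_shortComplexKer h.surjective).extClass.comp
    (h.shortExact_leftHalf.extClass.comp
      (Ext.mk₀ (ModuleCat.ofHom φ)) (add_zero 1)) (one_add_one_eq_two)
  map_zero' := by
    rw [ModuleCat.ofHom_zero, Ext.mk₀_zero, Ext.comp_zero, Ext.comp_zero]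
  map_add' φ φ' := by
    rw [ModuleCat.ofHom_add, Ext.mk₀_add, Ext.comp_add, Ext.comp_add]

/-- A class is pulled back through two connecting maps: from degree 2 to 1 by projectivity of `T`,
then from degree 1 to 0 by projectivity of `P`. -/
theorem extTwo_surjective (h : IsFourTermExact ι g f) [Module.Projective R T]
    [Module.Projective R P] : Function.Surjective (h.extTwo A) := by
  intro x
  have : Projective (ModuleCat.of R T) := (IsProjective.iff_projective T).1 inferInstance
  have : Projective (ModuleCat.of R P) := (IsProjective.iff_projective P).1 inferInstance
  obtain ⟨y, rfl⟩ := (LinearMap.shortExact_shortComplexKer h.surjective).extClass_comp_surjective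
    _ one_add_one_eq_two x
  obtain ⟨z, rfl⟩ := h.shortExact_leftHalf.extClass_comp_surjective _ (add_zero 1) y
  obtain ⟨z, rfl⟩ := (Ext.mk₀_bijective _ _).2 z
  exact ⟨z.hom, rfl⟩

theorem extTwo_eq_zero_iff (h : IsFourTermExact ι g f) [Module.Projective R T] {φ : K →ₗ[R] A} :
    h.extTwo A φ = 0 ↔ ∃ ψ : P →ₗ[R] A, ψ ∘ₗ ι = φ := by
  constructor
  · intro hh
    have : Projective (ModuleCat.of R T) := (IsProjective.iff_projective T).1 inferInstance
    -- The outer connecting map, from degree 1 to degree 2, is injective because `T` is projective,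
    -- so the inner class already vanishes.
    have h1 := (LinearMap.shortExact_shortComplexKer h.surjective).extClass_comp_eq_zero _
      (n := 0) one_add_one_eq_two hh
    obtain ⟨z, hz⟩ := h.shortExact_leftHalf.extClass_comp_mk₀_eq_zero h1
    exact ⟨z.hom, congrArg ModuleCat.Hom.hom hz⟩
  · rintro ⟨ψ, rfl⟩
    have h1 : Ext.mk₀ (ModuleCat.ofHom (ψ ∘ₗ ι)) =
        (Ext.mk₀ h.leftHalf.f).comp (Ext.mk₀ (ModuleCat.ofHom ψ)) (zero_add 0) := by
      rw [Ext.mk₀_comp_mk₀]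
      rfl
    change (LinearMap.shortExact_shortComplexKer h.surjective).extClass.comp
      (h.shortExact_leftHalf.extClass.comp
        (Ext.mk₀ (ModuleCat.ofHom _)) (add_zero 1)) one_add_one_eq_two = 0
    -- An extension class becomes zero after composition with the inclusion of its own kernel term.
    rw [h1, ShortComplex.ShortExact.extClass_comp_assoc, Ext.comp_zero]

end IsFourTermExact

end DimensionShift

/-! ### Permutation modules -/

namespace PermModule

variable {S : Type u} [Group S] {X : Type u} [MulAction S X]

variable (S) in
/-- The basis vector of `ℤ[X]` at `x`. -/
noncomputable def of (x : X) : PermModule S X :=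
  (Representation.asModuleEquiv _).symm (MonoidAlgebra.single x 1)

theorem single_smul_of (g : S) (x : X) :
    MonoidAlgebra.single g (1 : ℤ) • of S x = of S (g • x) := by
  rw [Representation.single_smul, one_smul, of, LinearEquiv.apply_symm_apply,
    Representation.ofMulAction_single]
  rfl

/-- The additive extension of a map on the basis. -/
noncomputable def addLift {B : Type*} [AddCommGroup B] (φ : X → B) : PermModule S X →+ B :=
  ((Finsupp.linearCombination ℤ φ) ∘ₗ (MonoidAlgebra.coeffLinearEquiv ℤ).toLinearMap ∘ₗ
    (Representation.asModuleEquiv _).toLinearMap).toAddMonoidHom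

@[simp] theorem addLift_of {B : Type*} [AddCommGroup B] (φ : X → B) (x : X) :
    addLift φ (of S x) = φ x := by
  change Finsupp.linearCombination ℤ φ (Finsupp.single x 1) = φ x
  simp

theorem addHom_ext {B : Type*} [AddCommGroup B] {φ ψ : PermModule S X →+ B}
    (h : ∀ x, φ (of S x) = ψ (of S x)) : φ = ψ := by
  have h1 : φ.toIntLinearMap ∘ₗ (Representation.asModuleEquiv _).symm.toLinearMap ∘ₗ
      (MonoidAlgebra.coeffLinearEquiv ℤ).symm.toLinearMap =
      ψ.toIntLinearMap ∘ₗ (Representation.asModuleEquiv _).symm.toLinearMap ∘ₗ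
      (MonoidAlgebra.coeffLinearEquiv ℤ).symm.toLinearMap := by
    refine Finsupp.lhom_ext' fun x => LinearMap.ext_ring ?_
    exact h x
  ext m
  exact LinearMap.congr_fun h1 (MonoidAlgebra.coeffLinearEquiv ℤ
    (Representation.asModuleEquiv _ m))

/-- An additive map between `ℤS`-modules that commutes with the elements of `S` is linear. -/
noncomputable def linearOfEquivariant {V W : Type*} [AddCommGroup V] [AddCommGroup W]
    [Module (MonoidAlgebra ℤ S) V] [Module (MonoidAlgebra ℤ S) W] (φ : V →+ W)
    (h : ∀ (g : S) (v : V), φ (MonoidAlgebra.single g (1 : ℤ) • v) =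
      MonoidAlgebra.single g (1 : ℤ) • φ v) : V →ₗ[MonoidAlgebra ℤ S] W :=
  MonoidAlgebra.equivariantOfLinearOfComm φ.toIntLinearMap h

variable {V : Type*} [AddCommGroup V] [Module (MonoidAlgebra ℤ S) V]

/-- The linear extension of an equivariant map on the basis. -/
noncomputable def lift (φ : X → V)
    (h : ∀ (g : S) (x : X), φ (g • x) = MonoidAlgebra.single g (1 : ℤ) • φ x) :
    PermModule S X →ₗ[MonoidAlgebra ℤ S] V :=
  linearOfEquivariant (addLift φ) fun g v => by
    have h1 : (addLift φ).comp (DistribSMul.toAddMonoidHom (PermModule S X)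
        (MonoidAlgebra.single g (1 : ℤ))) =
        (DistribSMul.toAddMonoidHom V (MonoidAlgebra.single g (1 : ℤ))).comp (addLift φ) :=
      addHom_ext fun x => by
        change addLift φ (MonoidAlgebra.single g (1 : ℤ) • of S x) =
          MonoidAlgebra.single g (1 : ℤ) • addLift φ (of S x)
        rw [single_smul_of, addLift_of, addLift_of, h]
    exact DFunLike.congr_fun h1 v

@[simp] theorem lift_of (φ : X → V)
    (h : ∀ (g : S) (x : X), φ (g • x) = MonoidAlgebra.single g (1 : ℤ) • φ x) (x : X) :
    lift φ h (of S x) = φ x := addLift_of φ x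

theorem hom_ext {φ ψ : PermModule S X →ₗ[MonoidAlgebra ℤ S] V}
    (h : ∀ x, φ (of S x) = ψ (of S x)) : φ = ψ := by
  have h1 : φ.toAddMonoidHom = ψ.toAddMonoidHom := addHom_ext h
  exact LinearMap.toAddMonoidHom_injective h1

/-- The permutation module of an `S`-set that maps to the free `S`-set `S` is projective. -/
theorem projective (ρ : X → S) (hρ : ∀ (g : S) (x : X), ρ (g • x) = g * ρ x) :
    Module.Projective (MonoidAlgebra ℤ S) (PermModule S X) := by
  refine Module.Projective.of_lifting_property'' fun φ hφ => ?_
  choose m hm using hφ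
  -- The chosen lifts `m` are not equivariant, so they are used only over the fibre ρ = 1, where
  -- ρ(x)⁻¹x lies, and are transported from there by ρ(x).
  refine ⟨lift (fun x => MonoidAlgebra.single (ρ x) (1 : ℤ) • m (of S ((ρ x)⁻¹ • x)))
    fun g x => ?_, hom_ext fun x => ?_⟩
  · rw [hρ, mul_inv_rev, mul_smul, inv_smul_smul, smul_smul, MonoidAlgebra.single_mul_single,
      one_mul]
  · rw [LinearMap.comp_apply, lift_of, map_smul, hm, single_smul_of, smul_inv_smul]
    rfl

end PermModule

/-! ### The resolution of `Λ_X` -/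

namespace MatchedPair

variable {G F : Type u} [Group G] [Group F] (M : MatchedPair G F)

/-- The `Σ`-set `F × G`. -/
@[ext]
structure Edge (M : MatchedPair G F) : Type u where
  x : F
  s : G

instance : MulAction M.Bowtie M.Edge where
  smul p z := ⟨M.actF p z.x, M.actG p z.s⟩
  one_smul z := Edge.ext (M.one_actF z.x) (M.one_actG z.s)
  mul_smul p q z := Edge.ext (M.mul_actF p q z.x) (M.mul_actG p q z.s)

/-- The `Σ`-set of pairs of two distinct points of `F` and two distinct points of `G`. -/
@[ext]
structure Cell (M : MatchedPair G F) : Type u where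
  x : F
  y : F
  s : G
  t : G
  ne : x ≠ y ∧ s ≠ t

instance : MulAction M.Bowtie M.Cell where
  smul p z := ⟨M.actF p z.x, M.actF p z.y, M.actG p z.s, M.actG p z.t,
    (M.actF_injective p).ne z.ne.1, (M.actG_injective p).ne z.ne.2⟩
  one_smul _ := Cell.ext (M.one_actF _) (M.one_actF _) (M.one_actG _) (M.one_actG _)
  mul_smul p q _ :=
    Cell.ext (M.mul_actF p q _) (M.mul_actF p q _) (M.mul_actG p q _) (M.mul_actG p q _)

/-- The free module `ℤ[F × G]`. -/
abbrev EdgeModule : Type u := PermModule M.Bowtie M.Edge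

/-- The free module of normalized `(1, 1)`-chains. -/
abbrev CellModule : Type u := PermModule M.Bowtie M.Cell

instance : Module.Projective (MonoidAlgebra ℤ M.Bowtie) M.EdgeModule :=
  PermModule.projective (fun z => M.toBowtie z.x z.s) fun g z => M.toBowtie_act g z.x z.s

instance : Module.Projective (MonoidAlgebra ℤ M.Bowtie) M.CellModule :=
  PermModule.projective (fun z => M.toBowtie z.x z.s) fun g z => M.toBowtie_act g z.x z.s

/-- The basis vector of `ℤ[F × G]` at `(x, s)`. -/
noncomputable def edge (x : F) (s : G) : M.EdgeModule := PermModule.of M.Bowtie ⟨x, s⟩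

theorem smul_edge (p : M.Bowtie) (x : F) (s : G) :
    MonoidAlgebra.single p (1 : ℤ) • M.edge x s = M.edge (M.actF p x) (M.actG p s) :=
  PermModule.single_smul_of _ _

open Classical in
/-- The `(1, 1)`-chain `[x, y] ⊗ [s, t]`, which is zero if degenerate. -/
noncomputable def cell (x y : F) (s t : G) : M.CellModule :=
  if h : x ≠ y ∧ s ≠ t then PermModule.of M.Bowtie ⟨x, y, s, t, h⟩ else 0

theorem cell_eq_of (z : M.Cell) : PermModule.of M.Bowtie z = M.cell z.x z.y z.s z.t := by
  rw [cell, dif_pos z.ne]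

@[simp] theorem cell_self_left (x : F) (s t : G) : M.cell x x s t = 0 :=
  dif_neg fun h => h.1 rfl

@[simp] theorem cell_self_right (x y : F) (s : G) : M.cell x y s s = 0 :=
  dif_neg fun h => h.2 rfl

/-- A formula checked on nondegenerate squares holds on all of them as soon as it vanishes on
degenerate ones; later computations with cells thus need no case distinction. -/
theorem addHom_cell {B : Type*} [AddCommGroup B] (φ : M.CellModule →+ B) (n : F → F → G → G → B)
    (h1 : ∀ x s t, n x x s t = 0) (h2 : ∀ x y s, n x y s s = 0)
    (h : ∀ z : M.Cell, φ (PermModule.of M.Bowtie z) = n z.x z.y z.s z.t) (x y : F) (s t : G) :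
    φ (M.cell x y s t) = n x y s t := by
  by_cases hne : x ≠ y ∧ s ≠ t
  · rw [cell, dif_pos hne, h]
  · rw [cell, dif_neg hne, map_zero]
    by_cases hx : x = y
    · rw [hx, h1]
    · have hs : s = t := by
        by_contra hs
        exact hne ⟨hx, hs⟩
      rw [hs, h2]

theorem smul_cell (p : M.Bowtie) (x y : F) (s t : G) :
    MonoidAlgebra.single p (1 : ℤ) • M.cell x y s t =
      M.cell (M.actF p x) (M.actF p y) (M.actG p s) (M.actG p t) :=
  M.addHom_cell (DistribSMul.toAddMonoidHom M.CellModule (MonoidAlgebra.single p (1 : ℤ)))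
    (fun x y s t => M.cell (M.actF p x) (M.actF p y) (M.actG p s) (M.actG p t))
    (fun _ _ _ => M.cell_self_left _ _ _) (fun _ _ _ => M.cell_self_right _ _ _)
    (fun z => (PermModule.single_smul_of p z).trans (M.cell_eq_of (p • z))) x y s t

/-- The permutation module `ℤ[X]`. -/
abbrev PointModule : Type u := PermModule M.Bowtie M.CosetSet

/-- The map `ℤ[F × G] → ℤ[X]`, `(x, s) ↦ x - s`. -/
noncomputable def edgeToPoint : M.EdgeModule →ₗ[MonoidAlgebra ℤ M.Bowtie] M.PointModule :=
  PermModule.lift (fun z => PermModule.of M.Bowtie (.inF z.x) - PermModule.of M.Bowtie (.inG z.s))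
    fun p z => by
      rw [smul_sub, PermModule.single_smul_of, PermModule.single_smul_of]
      rfl

theorem edgeToPoint_edge (x : F) (s : G) :
    M.edgeToPoint (M.edge x s) =
      PermModule.of M.Bowtie (.inF x) - PermModule.of M.Bowtie (.inG s) :=
  PermModule.lift_of _ _ _

theorem augmentation_of {S X : Type u} [Group S] [MulAction S X] (x : X) :
    augmentation S X (PermModule.of S x) = (Representation.asModuleEquiv _).symm (1 : ℤ) :=
  augmentation_single S X x 1

theorem augmentation_edgeToPoint (m : M.EdgeModule) :
    M.edgeToPoint m ∈ LinearMap.ker (augmentation M.Bowtie M.CosetSet) := by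
  have h : (augmentation M.Bowtie M.CosetSet) ∘ₗ M.edgeToPoint = 0 :=
    PermModule.hom_ext fun z => by
      rw [LinearMap.comp_apply, edgeToPoint, PermModule.lift_of, map_sub, augmentation_of,
        augmentation_of, sub_self, LinearMap.zero_apply]
  exact LinearMap.congr_fun h m

/-- The map `ℤ[F × G] → Λ_X`, `(x, s) ↦ x - s`. -/
noncomputable def edgeToAug : M.EdgeModule →ₗ[MonoidAlgebra ℤ M.Bowtie]
    LinearMap.ker (augmentation M.Bowtie M.CosetSet) :=
  M.edgeToPoint.codRestrict _ M.augmentation_edgeToPoint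

/-- The map `ℤ[F² × G²] → ℤ[F × G]`, the product of the two boundary maps. -/
noncomputable def cellToEdge : M.CellModule →ₗ[MonoidAlgebra ℤ M.Bowtie] M.EdgeModule :=
  PermModule.lift (fun z => M.edge z.y z.t - M.edge z.y z.s - M.edge z.x z.t + M.edge z.x z.s)
    fun p z => by
      simp only [smul_add, smul_sub, smul_edge]
      rfl

theorem cellToEdge_cell (x y : F) (s t : G) :
    M.cellToEdge (M.cell x y s t) = M.edge y t - M.edge y s - M.edge x t + M.edge x s :=
  M.addHom_cell M.cellToEdge.toAddMonoidHom
    (fun x y s t => M.edge y t - M.edge y s - M.edge x t + M.edge x s)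
    (fun _ _ _ => by abel) (fun _ _ _ => by abel) (fun z => by
      change M.cellToEdge _ = _
      rw [cellToEdge, PermModule.lift_of]) x y s t

theorem edgeToPoint_cellToEdge (m : M.CellModule) : M.edgeToPoint (M.cellToEdge m) = 0 := by
  have h : M.edgeToPoint ∘ₗ M.cellToEdge = 0 :=
    PermModule.hom_ext fun z => by
      rw [LinearMap.comp_apply, cell_eq_of, cellToEdge_cell]
      simp only [map_add, map_sub, edgeToPoint_edge, LinearMap.zero_apply]
      abel
  exact LinearMap.congr_fun h m

/-- A contracting homotopy `ℤ[X] → ℤ[F × G]`. -/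
noncomputable def pointToEdge : M.PointModule →+ M.EdgeModule :=
  PermModule.addLift fun z => match z with
    | .inF x => M.edge x 1
    | .inG s => M.edge 1 1 - M.edge 1 s

/-- A contracting homotopy `ℤ[F × G] → ℤ[F² × G²]`. -/
noncomputable def edgeToCell : M.EdgeModule →+ M.CellModule :=
  PermModule.addLift fun z => M.cell 1 z.x 1 z.s

theorem edgeToCell_edge (x : F) (s : G) : M.edgeToCell (M.edge x s) = M.cell 1 x 1 s :=
  PermModule.addLift_of _ _

theorem pointToEdge_inF (x : F) :
    M.pointToEdge (PermModule.of M.Bowtie (.inF x)) = M.edge x 1 := PermModule.addLift_of _ _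

theorem pointToEdge_inG (s : G) :
    M.pointToEdge (PermModule.of M.Bowtie (.inG s)) = M.edge 1 1 - M.edge 1 s :=
  PermModule.addLift_of _ _

/-- The edge (x, s) differs from the path through the base points by the boundary of the square [1,
x] ⊗ [1, s]. This gives exactness at the edges. -/
theorem homotopy_edge (m : M.EdgeModule) :
    M.pointToEdge (M.edgeToPoint m) + M.cellToEdge (M.edgeToCell m) = m := by
  have h : M.pointToEdge.comp M.edgeToPoint.toAddMonoidHom +
      M.cellToEdge.toAddMonoidHom.comp M.edgeToCell = AddMonoidHom.id _ :=
    PermModule.addHom_ext fun z => by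
      change M.pointToEdge (M.edgeToPoint (M.edge z.x z.s)) +
        M.cellToEdge (M.edgeToCell (M.edge z.x z.s)) = M.edge z.x z.s
      rw [edgeToPoint_edge, edgeToCell_edge, cellToEdge_cell, map_sub, pointToEdge_inF,
        pointToEdge_inG]
      abel
  exact DFunLike.congr_fun h m

/-- Each vertex is joined to the base vertex 1 of G, directly from F and through 1 of F from G. The
correction term is the augmentation times that base vertex, so it disappears on Λ_X. -/
theorem homotopy_point (m : M.PointModule) :
    M.edgeToPoint (M.pointToEdge m) + PermModule.addLift (S := M.Bowtie) (X := M.CosetSet)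
      (fun _ => PermModule.of M.Bowtie (CosetSet.inG 1 : M.CosetSet)) m = m := by
  have h : M.edgeToPoint.toAddMonoidHom.comp M.pointToEdge +
      PermModule.addLift (S := M.Bowtie) (X := M.CosetSet)
      (fun _ => PermModule.of M.Bowtie (CosetSet.inG 1 : M.CosetSet)) = AddMonoidHom.id _ :=
    PermModule.addHom_ext fun z => by
      change M.edgeToPoint (M.pointToEdge (PermModule.of M.Bowtie z)) + _ = PermModule.of M.Bowtie z
      rw [PermModule.addLift_of]
      cases z with
      | inF x => rw [pointToEdge_inF, edgeToPoint_edge, sub_add_cancel]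
      | inG s =>
        rw [pointToEdge_inG, map_sub, edgeToPoint_edge, edgeToPoint_edge]
        abel
  exact DFunLike.congr_fun h m

theorem addLift_const {S X : Type u} {B : Type*} [Group S] [MulAction S X] [AddCommGroup B] (b : B)
    (m : PermModule S X) : PermModule.addLift (fun _ => b) m =
      (Representation.asModuleEquiv _ (augmentation S X m) : ℤ) • b := by
  have h : PermModule.addLift (fun _ => b) = (zmultiplesHom B b).comp
      ((Representation.asModuleEquiv _).toAddMonoidHom.comp
        (augmentation S X).toAddMonoidHom) :=
    PermModule.addHom_ext fun x => by
      rw [PermModule.addLift_of]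
      change b = (Representation.asModuleEquiv _ (augmentation S X (PermModule.of S x)) : ℤ) • b
      rw [augmentation_of, LinearEquiv.apply_symm_apply, one_smul]
  exact DFunLike.congr_fun h m

theorem edgeToAug_surjective : Function.Surjective M.edgeToAug := by
  rintro ⟨m, hm⟩
  refine ⟨M.pointToEdge m, Subtype.ext ?_⟩
  have h := M.homotopy_point m
  rw [addLift_const, LinearMap.mem_ker.1 hm, map_zero, zero_zsmul, add_zero] at h
  exact h

/-- The second syzygy of `Λ_X`. -/
abbrev Syzygy : Type u := LinearMap.ker M.cellToEdge

/-- The inclusion of the syzygy in the module of `(1, 1)`-chains. -/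
noncomputable abbrev syzygyIncl : M.Syzygy →ₗ[MonoidAlgebra ℤ M.Bowtie] M.CellModule :=
  (LinearMap.ker M.cellToEdge).subtype

theorem isFourTermExact : IsFourTermExact (K := M.Syzygy) (P := M.CellModule)
    (T := M.EdgeModule) (L := LinearMap.ker (augmentation M.Bowtie M.CosetSet)) M.syzygyIncl M.cellToEdge M.edgeToAug where
  injective := Subtype.val_injective
  exact_left m := ⟨fun hm => ⟨⟨m, hm⟩, rfl⟩, fun ⟨m', hm'⟩ => hm' ▸ m'.2⟩
  exact_right m := by
    refine ⟨fun hm => ⟨M.edgeToCell m, ?_⟩, ?_⟩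
    · have h := M.homotopy_edge m
      have hm' : M.edgeToPoint m = 0 := congrArg Subtype.val hm
      rwa [hm', map_zero, zero_add] at h
    · rintro ⟨m', rfl⟩
      exact Subtype.ext (M.edgeToPoint_cellToEdge m')
  surjective := M.edgeToAug_surjective

/-! ### Generators of the syzygy -/

/-- The boundary of the `(2, 1)`-chain `[x, y, z] ⊗ [s, t]`. -/
noncomputable def bdF (x y z : F) (s t : G) : M.CellModule :=
  M.cell y z s t + M.cell x y s t - M.cell x z s t

/-- The boundary of the `(1, 2)`-chain `[x, y] ⊗ [s, t, u]`. -/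
noncomputable def bdG (x y : F) (s t u : G) : M.CellModule :=
  M.cell x y t u + M.cell x y s t - M.cell x y s u

theorem bdF_mem (x y z : F) (s t : G) : M.bdF x y z s t ∈ LinearMap.ker M.cellToEdge := by
  rw [LinearMap.mem_ker, bdF, map_sub, map_add]
  simp only [cellToEdge_cell]
  abel

theorem bdG_mem (x y : F) (s t u : G) : M.bdG x y s t u ∈ LinearMap.ker M.cellToEdge := by
  rw [LinearMap.mem_ker, bdG, map_sub, map_add]
  simp only [cellToEdge_cell]
  abel

/-- The boundary of a `(2, 1)`-chain, as an element of the syzygy. -/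
noncomputable def sF (x y z : F) (s t : G) : M.Syzygy := ⟨M.bdF x y z s t, M.bdF_mem x y z s t⟩

/-- The boundary of a `(1, 2)`-chain, as an element of the syzygy. -/
noncomputable def sG (x y : F) (s t u : G) : M.Syzygy := ⟨M.bdG x y s t u, M.bdG_mem x y s t u⟩

theorem smul_sF (p : M.Bowtie) (x y z : F) (s t : G) :
    MonoidAlgebra.single p (1 : ℤ) • M.sF x y z s t =
      M.sF (M.actF p x) (M.actF p y) (M.actF p z) (M.actG p s) (M.actG p t) := by
  refine Subtype.ext ?_
  change MonoidAlgebra.single p (1 : ℤ) • M.bdF x y z s t = _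
  rw [bdF, smul_sub, smul_add, smul_cell, smul_cell, smul_cell]
  rfl

theorem smul_sG (p : M.Bowtie) (x y : F) (s t u : G) :
    MonoidAlgebra.single p (1 : ℤ) • M.sG x y s t u =
      M.sG (M.actF p x) (M.actF p y) (M.actG p s) (M.actG p t) (M.actG p u) := by
  refine Subtype.ext ?_
  change MonoidAlgebra.single p (1 : ℤ) • M.bdG x y s t u = _
  rw [bdG, smul_sub, smul_add, smul_cell, smul_cell, smul_cell]
  rfl

/-- The boundaries generate the syzygy as an abelian group. -/
theorem syzygy_induction {B : Type*} [AddCommGroup B] {φ ψ : M.Syzygy →+ B}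
    (hF : ∀ x y z s t, φ (M.sF x y z s t) = ψ (M.sF x y z s t))
    (hG : ∀ x y s t u, φ (M.sG x y s t u) = ψ (M.sG x y s t u)) : φ = ψ := by
  -- The homotopy gives a retraction onto the syzygy. It is additive but not equivariant, since it
  -- depends on the base points.
  let proj : M.CellModule →+ M.Syzygy :=
    { toFun := fun m => ⟨m - M.edgeToCell (M.cellToEdge m), by
        have h := M.homotopy_edge (M.cellToEdge m)
        rw [edgeToPoint_cellToEdge, map_zero, zero_add] at h
        rw [LinearMap.mem_ker, map_sub, h, sub_self]⟩
      map_zero' := Subtype.ext (by simp)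
      map_add' := fun m m' => Subtype.ext (by
        simp only [map_add, Submodule.coe_add]
        abel) }
  have hproj : ∀ m : M.Syzygy, proj m = m := fun m => Subtype.ext (by
    change (m : M.CellModule) - M.edgeToCell (M.cellToEdge m) = m
    rw [LinearMap.mem_ker.1 m.2, map_zero, sub_zero])
  -- The retraction of a square is an explicit combination of three boundaries. Reading this
  -- combination in kˣ gives exactly the formula for `potential`.
  have hcell : ∀ x y s t, proj (M.cell x y s t) + M.sG 1 x 1 s t =
      M.sG 1 y 1 s t + M.sF 1 x y s t := fun x y s t => Subtype.ext (by
    change M.cell x y s t - M.edgeToCell (M.cellToEdge (M.cell x y s t)) + M.bdG 1 x 1 s t =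
      M.bdG 1 y 1 s t + M.bdF 1 x y s t
    simp only [cellToEdge_cell, map_add, map_sub, edgeToCell_edge, bdF, bdG]
    abel)
  have h : φ.comp proj = ψ.comp proj := PermModule.addHom_ext fun z => by
    rw [cell_eq_of, AddMonoidHom.comp_apply, AddMonoidHom.comp_apply,
      ← add_left_inj (φ (M.sG 1 z.x 1 z.s z.t)), ← map_add, hcell, hG, ← map_add, hcell,
      map_add, map_add, hF, hG]
  ext m
  rw [← hproj m]
  exact DFunLike.congr_fun h (m : M.CellModule)

end MatchedPair

/-! ### Cocycles and homomorphisms from the syzygy -/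

theorem TrivModule.single_smul {S A : Type*} [Group S] [AddCommGroup A] (g : S)
    (a : TrivModule S A) : MonoidAlgebra.single g (1 : ℤ) • a = a := by
  rw [Representation.single_smul, one_smul]
  rfl

namespace MatchedPair

variable {k G F : Type u} [Field k] [Group G] [Group F] {M : MatchedPair G F}

variable (k M) in
/-- The trivial module `kˣ`. -/
abbrev UnitsModule : Type u := TrivModule M.Bowtie (Additive kˣ)

variable {V : Type*} [AddCommGroup V] [Module (MonoidAlgebra ℤ M.Bowtie) V]

/-- The value in `kˣ` of a homomorphism to the trivial module. -/
noncomputable def unitVal (h : V →ₗ[MonoidAlgebra ℤ M.Bowtie] UnitsModule k M) (v : V) : kˣ :=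
  Additive.toMul (Representation.asModuleEquiv _ (h v))

variable (h : V →ₗ[MonoidAlgebra ℤ M.Bowtie] UnitsModule k M)

theorem unitVal_add (v w : V) : unitVal h (v + w) = unitVal h v * unitVal h w := by
  simp [unitVal]

theorem unitVal_sub (v w : V) : unitVal h (v - w) = unitVal h v / unitVal h w := by
  simp [unitVal]

theorem unitVal_zero : unitVal h 0 = 1 := by
  simp [unitVal]

theorem unitVal_smul (p : M.Bowtie) (v : V) :
    unitVal h (MonoidAlgebra.single p (1 : ℤ) • v) = unitVal h v := by
  rw [unitVal, map_smul, TrivModule.single_smul, unitVal]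

theorem unitVal_hom_add (h h' : V →ₗ[MonoidAlgebra ℤ M.Bowtie] UnitsModule k M) (v : V) :
    unitVal (h + h') v = unitVal h v * unitVal h' v := by
  simp [unitVal]

/-- The action on the target is trivial, so the square may be moved to the base edge without
changing the value. `unitVal_sF` and `unitVal_sG` do the same for boundaries. -/
theorem unitVal_cell (φ : M.CellModule →ₗ[MonoidAlgebra ℤ M.Bowtie] UnitsModule k M)
    (x y : F) (s t : G) : unitVal φ (M.cell x y s t) =
      unitVal φ (M.cell 1 (M.diffF x y t) (M.diffG x s t) 1) := by
  rw [← unitVal_smul φ (M.toBowtie x t) (M.cell 1 _ _ 1), smul_cell, M.toBowtie_actF,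
    M.toBowtie_actG, M.toBowtie_actF_one, M.toBowtie_actG_one]

variable (h : M.Syzygy →ₗ[MonoidAlgebra ℤ M.Bowtie] UnitsModule k M)

theorem unitVal_sF (x y z : F) (s t : G) : unitVal h (M.sF x y z s t) =
    unitVal h (M.sF 1 (M.diffF x y t) (M.diffF x z t) (M.diffG x s t) 1) := by
  rw [← unitVal_smul h (M.toBowtie x t) (M.sF 1 _ _ _ 1), smul_sF, M.toBowtie_actF,
    M.toBowtie_actF, M.toBowtie_actG, M.toBowtie_actF_one, M.toBowtie_actG_one]

theorem unitVal_sG (x y : F) (s t u : G) : unitVal h (M.sG x y s t u) =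
    unitVal h (M.sG 1 (M.diffF x y u) (M.diffG x s u) (M.diffG x t u) 1) := by
  rw [← unitVal_smul h (M.toBowtie x u) (M.sG 1 _ _ _ 1), smul_sG, M.toBowtie_actF,
    M.toBowtie_actG, M.toBowtie_actG, M.toBowtie_actF_one, M.toBowtie_actG_one]

/-- This is ∂∂ = 0 for the (3,1)-chain [x, y, z, w] ⊗ [s, t]; `sG_relation` is the same for a
(1,3)-chain. -/
theorem sF_relation (x y z w : F) (s t : G) :
    M.sF y z w s t + M.sF x y w s t = M.sF x y z s t + M.sF x z w s t := by
  refine Subtype.ext ?_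
  change M.bdF y z w s t + M.bdF x y w s t = M.bdF x y z s t + M.bdF x z w s t
  simp only [bdF]
  abel

theorem sG_relation (x y : F) (s t u v : G) :
    M.sG x y s t u + M.sG x y s u v = M.sG x y t u v + M.sG x y s t v := by
  refine Subtype.ext ?_
  change M.bdG x y s t u + M.bdG x y s u v = M.bdG x y t u v + M.bdG x y s t v
  simp only [bdG]
  abel

/-- This is ∂∂ = 0 for the (2,2)-chain [x, y, z] ⊗ [s, t, u], the source of the compatibility
condition. -/
theorem sF_sG_relation (x y z : F) (s t u : G) :
    M.sF x y z s u + (M.sG x y s t u + M.sG y z s t u) =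
      M.sF x y z s t + M.sF x y z t u + M.sG x z s t u := by
  refine Subtype.ext ?_
  change M.bdF x y z s u + (M.bdG x y s t u + M.bdG y z s t u) =
    M.bdF x y z s t + M.bdF x y z t u + M.bdG x z s t u
  simp only [bdF, bdG]
  abel

theorem sF_left (x z : F) (s t : G) : M.sF x x z s t = 0 := by
  refine Subtype.ext ?_
  change M.bdF x x z s t = 0
  simp [bdF]

theorem sF_right (x z : F) (s t : G) : M.sF x z z s t = 0 := by
  refine Subtype.ext ?_
  change M.bdF x z z s t = 0
  simp [bdF]

theorem sF_self (x y z : F) (s : G) : M.sF x y z s s = 0 := by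
  refine Subtype.ext ?_
  change M.bdF x y z s s = 0
  simp [bdF]

theorem sG_left (x y : F) (s u : G) : M.sG x y s s u = 0 := by
  refine Subtype.ext ?_
  change M.bdG x y s s u = 0
  simp [bdG]

theorem sG_right (x y : F) (s u : G) : M.sG x y s u u = 0 := by
  refine Subtype.ext ?_
  change M.bdG x y s u u = 0
  simp [bdG]

theorem sG_self (x : F) (s t u : G) : M.sG x x s t u = 0 := by
  refine Subtype.ext ?_
  change M.bdG x x s t u = 0
  simp [bdG]

/-- The pair of cocycles of a homomorphism from the syzygy to `kˣ`. -/
noncomputable def cocycleOfHom : CocyclePair k M where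
  σ s x y := unitVal h (M.sF 1 x (x * y) s 1)
  -- The inverse is forced by the mixed relation: there the terms of G-type stand on the opposite
  -- side from where τ stands in the compatibility condition.
  τ s t x := (unitVal h (M.sG 1 x (s * t) t 1))⁻¹
  σ_cocycle s x y z := by
    -- Invariance rewrites σ(s ◁ x; y, z) as the value at the vertices x, xy, xyz, so that all four
    -- factors come from faces of the single chain on 1, x, xy, xyz.
    have h1 := unitVal_sF h x (x * y) (x * y * z) s 1
    simp only [diffF_one_right, diffG_one_right, mul_assoc, inv_mul_cancel_left] at h1
    rw [← h1, ← unitVal_add, ← unitVal_add, sF_relation]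
    simp only [mul_assoc]
  τ_cocycle s t u x := by
    have h1 := unitVal_sG h 1 x (s * t * u) (t * u) u
    simp only [diffF_one_left, diffG_one_left, mul_inv_cancel_right] at h1
    rw [← h1, ← mul_inv, ← mul_inv, ← unitVal_add, ← unitVal_add, sG_relation, mul_assoc]
  σ_one_left s x := by rw [sF_left, unitVal_zero]
  σ_one_right s x := by rw [mul_one, sF_right, unitVal_zero]
  σ_one x y := by rw [sF_self, unitVal_zero]
  τ_one_left s x := by rw [one_mul, sG_left, unitVal_zero, inv_one]
  τ_one_right s x := by rw [mul_one, sG_right, unitVal_zero, inv_one]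
  τ_one s t := by rw [sG_self, unitVal_zero, inv_one]
  compatible s t x y := by
    -- The two translated factors are placed on the (2,2)-chain [1, x, xy] ⊗ [st, t, 1].
    have h1 := unitVal_sF h 1 x (x * y) (s * t) t
    simp only [diffF_one_left, diffG_one_left, mul_inv_cancel_right, M.lact_mul] at h1
    have h2 := unitVal_sG h x (x * y) (s * t) t 1
    simp only [diffF_one_right, diffG_one_right, inv_mul_cancel_left, M.mul_ract] at h2
    rw [← h1, ← h2, ← div_eq_mul_inv, ← mul_inv, ← div_eq_mul_inv, div_eq_div_iff_mul_eq_mul,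
      ← unitVal_add, ← unitVal_add, ← unitVal_add, ← unitVal_add, sF_sG_relation]

@[simp] theorem cocycleOfHom_σ (s : G) (x y : F) :
    (cocycleOfHom h).σ s x y = unitVal h (M.sF 1 x (x * y) s 1) := rfl

@[simp] theorem cocycleOfHom_τ (s t : G) (x : F) :
    (cocycleOfHom h).τ s t x = (unitVal h (M.sG 1 x (s * t) t 1))⁻¹ := rfl

theorem unitVal_sF_eq (x y z : F) (s t : G) :
    unitVal h (M.sF x y z s t) = (cocycleOfHom h).homσ x y z s t := by
  rw [unitVal_sF, CocyclePair.homσ, cocycleOfHom_σ, M.diffF_mul]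

theorem unitVal_sG_eq (x y : F) (s t u : G) :
    unitVal h (M.sG x y s t u) = ((cocycleOfHom h).homτ x y s t u)⁻¹ := by
  rw [unitVal_sG, CocyclePair.homτ, cocycleOfHom_τ, M.diffG_mul, inv_inv]

/-- Every generator of the syzygy takes a value of `homσ` or an inverse value of `homτ`, so the pair
determines the homomorphism. -/
theorem cocycleOfHom_injective : Function.Injective (cocycleOfHom (k := k) (M := M)) := by
  intro h h' e
  have h1 : h.toAddMonoidHom = h'.toAddMonoidHom := by
    apply M.syzygy_induction
    · intro x y z s t
      have h2 := unitVal_sF_eq h x y z s t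
      rw [e, ← unitVal_sF_eq] at h2
      exact h2
    · intro x y s t u
      have h2 := unitVal_sG_eq h x y s t u
      rw [e, ← unitVal_sG_eq] at h2
      exact h2
  exact LinearMap.toAddMonoidHom_injective h1

/-- The additive map on `(1, 1)`-chains given by the potential of a pair of cocycles. -/
noncomputable def potentialHom (c : CocyclePair k M) : M.CellModule →+ Additive kˣ :=
  PermModule.addLift fun z => Additive.ofMul (c.potential z.x z.y z.s z.t)

theorem potentialHom_cell (c : CocyclePair k M) (x y : F) (s t : G) :
    potentialHom c (M.cell x y s t) = Additive.ofMul (c.potential x y s t) :=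
  M.addHom_cell (potentialHom c) (fun x y s t => Additive.ofMul (c.potential x y s t))
    (fun _ _ _ => by rw [c.potential_self_left, ofMul_one])
    (fun _ _ _ => by rw [c.potential_self_right, ofMul_one])
    (fun _ => PermModule.addLift_of _ _) x y s t

theorem potentialHom_sF (c : CocyclePair k M) (x y z : F) (s t : G) :
    potentialHom c (M.sF x y z s t : M.Syzygy) = Additive.ofMul (c.homσ x y z s t) := by
  change potentialHom c (M.bdF x y z s t) = _
  rw [bdF, map_sub, map_add, potentialHom_cell, potentialHom_cell, potentialHom_cell,
    ← c.potential_F]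
  rfl

theorem potentialHom_sG (c : CocyclePair k M) (x y : F) (s t u : G) :
    potentialHom c (M.sG x y s t u : M.Syzygy) = Additive.ofMul (c.homτ x y s t u)⁻¹ := by
  change potentialHom c (M.bdG x y s t u) = _
  rw [bdG, map_sub, map_add, potentialHom_cell, potentialHom_cell, potentialHom_cell,
    ← c.potential_G]
  rfl

/-- The potential itself depends on the base points, but on the generating boundaries it takes the
values of the homogeneous cochains, which are functions of invariant differences. -/
theorem potentialHom_smul (c : CocyclePair k M) (p : M.Bowtie) (v : M.Syzygy) :
    potentialHom c (MonoidAlgebra.single p (1 : ℤ) • v : M.Syzygy) = potentialHom c v := by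
  let φ : M.Syzygy →+ Additive kˣ := (potentialHom c).comp M.syzygyIncl.toAddMonoidHom
  have h1 : φ.comp (DistribSMul.toAddMonoidHom M.Syzygy (MonoidAlgebra.single p (1 : ℤ))) =
      φ := by
    apply M.syzygy_induction
    · intro x y z s t
      change potentialHom c (MonoidAlgebra.single p (1 : ℤ) • M.sF x y z s t : M.Syzygy) =
        potentialHom c (M.sF x y z s t : M.Syzygy)
      rw [smul_sF, potentialHom_sF, potentialHom_sF, c.homσ_act]
    · intro x y s t u
      change potentialHom c (MonoidAlgebra.single p (1 : ℤ) • M.sG x y s t u : M.Syzygy) =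
        potentialHom c (M.sG x y s t u : M.Syzygy)
      rw [smul_sG, potentialHom_sG, potentialHom_sG, c.homτ_act]
  exact DFunLike.congr_fun h1 v

/-- The homomorphism from the syzygy to `kˣ` given by a pair of cocycles. -/
noncomputable def homOfCocycle (c : CocyclePair k M) :
    M.Syzygy →ₗ[MonoidAlgebra ℤ M.Bowtie] UnitsModule k M :=
  PermModule.linearOfEquivariant (S := M.Bowtie) (V := M.Syzygy) (W := UnitsModule k M)
    ((Representation.asModuleEquiv (Representation.trivial ℤ M.Bowtie
      (Additive kˣ))).symm.toAddEquiv.toAddMonoidHom.comp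
      ((potentialHom c).comp M.syzygyIncl.toAddMonoidHom)) fun p v =>
    (potentialHom_smul c p v).trans (TrivModule.single_smul (A := Additive kˣ) p _).symm

theorem cocycleOfHom_homOfCocycle (c : CocyclePair k M) : cocycleOfHom (homOfCocycle c) = c := by
  apply CocyclePair.ext'
  · intro s x y
    rw [← c.homσ_one]
    exact congrArg Additive.toMul (potentialHom_sF c 1 x (x * y) s 1)
  · intro s t x
    rw [← c.homτ_one, ← inv_inv (c.homτ _ _ _ _ _)]
    exact congrArg (fun a => (Additive.toMul a)⁻¹) (potentialHom_sG c 1 x (s * t) t 1)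

theorem cocycleOfHom_comp_isCoboundaryOf
    (φ : M.CellModule →ₗ[MonoidAlgebra ℤ M.Bowtie] UnitsModule k M) :
    (cocycleOfHom (φ ∘ₗ M.syzygyIncl)).IsCoboundaryOf
      fun s x => unitVal φ (M.cell 1 x s 1) where
  one_left x := by rw [cell_self_right, unitVal_zero]
  one_right s := by rw [cell_self_left, unitVal_zero]
  σ_eq s x y := by
    change unitVal φ (M.bdF 1 x (x * y) s 1) = _
    rw [bdF, unitVal_sub, unitVal_add, unitVal_cell φ x (x * y), diffF_one_right, diffG_one_right,
      inv_mul_cancel_left, mul_comm (unitVal φ _)]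
  τ_eq s t x := by
    change (unitVal φ (M.bdG 1 x (s * t) t 1))⁻¹ = _
    rw [bdG, unitVal_sub, unitVal_add, unitVal_cell φ 1 x (s * t) t, diffF_one_left,
      diffG_one_left, mul_inv_cancel_right, inv_div, mul_comm (unitVal φ (M.cell _ _ t _))]

/-- Invariant homomorphisms on squares are the same as normalized cochains ν, because each square
has a unique translate at the base edge. -/
theorem cocycleOfHom_mem_coboundaries_iff :
    cocycleOfHom h ∈ CocyclePair.coboundaries k M ↔
      ∃ φ : M.CellModule →ₗ[MonoidAlgebra ℤ M.Bowtie] UnitsModule k M,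
        φ ∘ₗ M.syzygyIncl = h := by
  constructor
  · rintro ⟨ν, hν⟩
    -- The homogeneous form of ν, equivariant because the differences are invariant.
    let f : M.Cell → UnitsModule k M := fun z => (Representation.asModuleEquiv _).symm
      (Additive.ofMul (ν (M.diffG z.x z.s z.t) (M.diffF z.x z.y z.t)))
    have hf : ∀ (p : M.Bowtie) (z : M.Cell), f (p • z) = MonoidAlgebra.single p (1 : ℤ) • f z := by
      intro p z
      rw [TrivModule.single_smul]
      change (Representation.asModuleEquiv _).symm (Additive.ofMul
        (ν (M.diffG (M.actF p z.x) (M.actG p z.s) (M.actG p z.t))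
          (M.diffF (M.actF p z.x) (M.actF p z.y) (M.actG p z.t)))) = _
      rw [M.diffG_act, M.diffF_act]
    let φ : M.CellModule →ₗ[MonoidAlgebra ℤ M.Bowtie] UnitsModule k M := PermModule.lift f hf
    have hφ : ∀ s x, unitVal φ (M.cell 1 x s 1) = ν s x := by
      intro s x
      have h1 := M.addHom_cell φ.toAddMonoidHom (fun x y s t =>
        (Representation.asModuleEquiv (Representation.trivial ℤ M.Bowtie (Additive kˣ))).symm
          (Additive.ofMul (ν (M.diffG x s t) (M.diffF x y t))))
        (fun x s t => by rw [diffF_self, hν.one_right]; rfl)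
        (fun x y s => by rw [diffG_self, hν.one_left]; rfl)
        (fun z => PermModule.lift_of f hf z) 1 x s 1
      rw [diffG_one, diffF_one] at h1
      exact congrArg Additive.toMul h1
    refine ⟨φ, cocycleOfHom_injective ?_⟩
    have h2 := cocycleOfHom_comp_isCoboundaryOf φ
    apply CocyclePair.ext'
    · intro s x y
      rw [h2.σ_eq, hν.σ_eq, hφ, hφ, hφ]
    · intro s t x
      rw [h2.τ_eq, hν.τ_eq, hφ, hφ, hφ]
  · rintro ⟨φ, rfl⟩
    exact ⟨_, cocycleOfHom_comp_isCoboundaryOf φ⟩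

end MatchedPair

/-! ### Cocycle classes and Ext² -/

namespace MatchedPair

variable {k G F : Type u} [Field k] [Group G] [Group F] {M : MatchedPair G F}

variable (k M) in
/-- The pair of cocycles, as an additive homomorphism. -/
noncomputable def cocycleOfHomAdd :
    (M.Syzygy →ₗ[MonoidAlgebra ℤ M.Bowtie] UnitsModule k M) →+ Additive (CocyclePair k M) :=
  AddMonoidHom.mk' (fun h => Additive.ofMul (cocycleOfHom h)) fun h h' =>
    congrArg Additive.ofMul (CocyclePair.ext' (d := cocycleOfHom h * cocycleOfHom h')
      (fun s x y => by
        rw [CocyclePair.mul_σ, cocycleOfHom_σ, cocycleOfHom_σ, cocycleOfHom_σ, unitVal_hom_add]) (fun s t x => by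
        rw [CocyclePair.mul_τ, cocycleOfHom_τ, cocycleOfHom_τ, cocycleOfHom_τ, unitVal_hom_add,
          mul_inv]))

variable (k M) in
/-- Pairs of cocycles correspond to homomorphisms from the syzygy to `kˣ`. -/
noncomputable def homEquivCocycle :
    (M.Syzygy →ₗ[MonoidAlgebra ℤ M.Bowtie] UnitsModule k M) ≃+ Additive (CocyclePair k M) :=
  AddEquiv.ofBijective (cocycleOfHomAdd k M)
    ⟨fun _ _ e => cocycleOfHom_injective (Additive.ofMul.injective e),
      fun c => ⟨homOfCocycle c.toMul, congrArg Additive.ofMul (cocycleOfHom_homOfCocycle _)⟩⟩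

variable (k M) in
/-- `Ext² (Λ_X, kˣ)`. -/
abbrev ExtTwo : Type u :=
  CategoryTheory.Abelian.Ext.{u}
    (ModuleCat.of (MonoidAlgebra ℤ M.Bowtie) (LinearMap.ker (augmentation M.Bowtie M.CosetSet)))
    (ModuleCat.of (MonoidAlgebra ℤ M.Bowtie) (UnitsModule k M)) 2

variable (k M) in
/-- The homomorphism from the group of pairs of cocycles to `Ext² (Λ_X, kˣ)`. -/
noncomputable def cocycleToExt : Additive (CocyclePair k M) →+ ExtTwo k M :=
  (M.isFourTermExact.extTwo (UnitsModule k M)).comp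
    (homEquivCocycle k M).symm.toAddMonoidHom

theorem cocycleToExt_apply (h : M.Syzygy →ₗ[MonoidAlgebra ℤ M.Bowtie] UnitsModule k M) :
    cocycleToExt k M (Additive.ofMul (cocycleOfHom h)) =
      M.isFourTermExact.extTwo (UnitsModule k M) h :=
  congrArg (M.isFourTermExact.extTwo (UnitsModule k M))
    ((homEquivCocycle k M).symm_apply_apply h)

theorem cocycleToExt_surjective : Function.Surjective (cocycleToExt k M) := by
  intro x
  obtain ⟨h, rfl⟩ := M.isFourTermExact.extTwo_surjective x
  exact ⟨_, cocycleToExt_apply h⟩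

theorem cocycleToExt_eq_zero_iff (c : CocyclePair k M) :
    cocycleToExt k M (Additive.ofMul c) = 0 ↔ c ∈ CocyclePair.coboundaries k M := by
  obtain ⟨h, rfl⟩ : ∃ h, cocycleOfHom h = c := ⟨_, cocycleOfHom_homOfCocycle c⟩
  rw [cocycleToExt_apply, M.isFourTermExact.extTwo_eq_zero_iff, cocycleOfHom_mem_coboundaries_iff]

variable (k M) in
/-- The homomorphism `cocycleToExt`, multiplicatively. -/
noncomputable def cocycleToExtMul : CocyclePair k M →* Multiplicative (ExtTwo k M) :=
  AddMonoidHom.toMultiplicativeRight (cocycleToExt k M)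

theorem cocycleToExtMul_surjective : Function.Surjective (cocycleToExtMul k M) := fun x => by
  obtain ⟨c, hc⟩ := cocycleToExt_surjective x.toAdd
  exact ⟨c.toMul, congrArg Multiplicative.ofAdd hc⟩

theorem ker_cocycleToExtMul : (cocycleToExtMul k M).ker = CocyclePair.coboundaries k M := by
  ext c
  exact cocycleToExt_eq_zero_iff c

variable (k M) in
/-- Classes of pairs of cocycles correspond to elements of `Ext² (Λ_X, kˣ)`. -/
noncomputable def cocycleClassEquivExt :
    (CocyclePair k M ⧸ CocyclePair.coboundaries k M) ≃* Multiplicative (ExtTwo k M) :=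
  (QuotientGroup.quotientMulEquivOfEq ker_cocycleToExtMul.symm).trans
    (QuotientGroup.quotientKerEquivOfSurjective _ cocycleToExtMul_surjective)

end MatchedPair

/-! ### The crossed product `k^G #_{σ,τ} kF` -/

theorem Module.Basis.induction_on {ι R A : Type*} [Semiring R] [AddCommMonoid A] [Module R A]
    (b : Module.Basis ι R A) {p : A → Prop} (a : A) (zero : p 0)
    (add : ∀ x y, p x → p y → p (x + y)) (smul : ∀ (r : R) x, p x → p (r • x))
    (basis : ∀ i, p (b i)) : p a := by
  have h := b.mem_span a
  induction h using Submodule.span_induction with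
  | mem x hx =>
    obtain ⟨i, rfl⟩ := hx
    exact basis i
  | zero => exact zero
  | add x y _ _ hx hy => exact add x y hx hy
  | smul r x _ hx => exact smul r x hx

namespace CocyclePair

variable {k G F : Type u} [Field k] [Group G] [Group F] {M : MatchedPair G F}

/-- The crossed product `k^G #_{σ,τ} kF`, as a vector space. -/
def CrossedProduct (_ : CocyclePair k M) : Type u := G × F →₀ k

variable (c : CocyclePair k M)

namespace CrossedProduct

noncomputable instance : AddCommGroup c.CrossedProduct := inferInstanceAs (AddCommGroup (_ →₀ _))
noncomputable instance : Module k c.CrossedProduct := inferInstanceAs (Module k (_ →₀ _))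

/-- The basis `e_s # x`. -/
noncomputable def basis : Module.Basis (G × F) k c.CrossedProduct :=
  Module.Basis.ofRepr (LinearEquiv.refl k (G × F →₀ k))

/-- The basis vector `e_s # x`. -/
noncomputable def v (s : G) (x : F) : c.CrossedProduct := basis c (s, x)

theorem linearMap_ext {W : Type*} [AddCommGroup W] [Module k W] {φ ψ : c.CrossedProduct →ₗ[k] W}
    (h : ∀ s x, φ (v c s x) = ψ (v c s x)) : φ = ψ :=
  (basis c).ext fun p => h p.1 p.2

/-- The linear map with given values on the basis. -/
noncomputable def lift {W : Type*} [AddCommGroup W] [Module k W] (f : G → F → W) :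
    c.CrossedProduct →ₗ[k] W := (basis c).constr k fun p => f p.1 p.2

@[simp] theorem lift_v {W : Type*} [AddCommGroup W] [Module k W] (f : G → F → W) (s : G) (x : F) :
    lift c f (v c s x) = f s x := (basis c).constr_basis _ _ _

open Classical in
/-- The product as a bilinear map. -/
noncomputable def mulLin : c.CrossedProduct →ₗ[k] c.CrossedProduct →ₗ[k] c.CrossedProduct :=
  lift c fun s x => lift c fun t y =>
    if M.ract s x = t then (c.σ s x y : k) • v c s (x * y) else 0

noncomputable instance : Mul c.CrossedProduct := ⟨fun a b => mulLin c a b⟩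

theorem mul_def (a b : c.CrossedProduct) : a * b = mulLin c a b := rfl

open Classical in
theorem v_mul_v (s t : G) (x y : F) : v c s x * v c t y =
    if M.ract s x = t then (c.σ s x y : k) • v c s (x * y) else 0 := by
  rw [mul_def, mulLin, lift_v, lift_v]

theorem v_mul_v_self (s : G) (x y : F) :
    v c s x * v c (M.ract s x) y = (c.σ s x y : k) • v c s (x * y) := by
  rw [v_mul_v, if_pos rfl]

theorem v_mul_v_of_ne {s t : G} {x : F} (h : M.ract s x ≠ t) (y : F) :
    v c s x * v c t y = 0 := by
  rw [v_mul_v, if_neg h]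

noncomputable instance : NonUnitalNonAssocRing c.CrossedProduct where
  left_distrib a b d := (mulLin c a).map_add b d
  right_distrib a b d := (mulLin c).map_add₂ a b d
  zero_mul a := (mulLin c).map_zero₂ a
  mul_zero a := (mulLin c a).map_zero

theorem smul_mul' (r : k) (a b : c.CrossedProduct) : r • a * b = r • (a * b) :=
  (mulLin c).map_smul₂ r a b

theorem mul_smul' (r : k) (a b : c.CrossedProduct) : a * r • b = r • (a * b) :=
  (mulLin c a).map_smul r b

theorem induction_on {p : c.CrossedProduct → Prop} (a : c.CrossedProduct) (zero : p 0)
    (add : ∀ a b, p a → p b → p (a + b)) (smul : ∀ (r : k) a, p a → p (r • a))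
    (basis : ∀ s x, p (v c s x)) : p a :=
  (CrossedProduct.basis c).induction_on a zero add smul fun i => basis i.1 i.2

/-- Both sides vanish unless t = s ◁ x and u = t ◁ y; in that case the scalars agree by the
σ-cocycle identity. -/
theorem v_mul_assoc (s t u : G) (x y z : F) :
    v c s x * v c t y * v c u z = v c s x * (v c t y * v c u z) := by
  by_cases h : M.ract s x = t
  · subst h
    rw [v_mul_v_self, smul_mul']
    by_cases h' : M.ract (M.ract s x) y = u
    · subst h'
      rw [v_mul_v_self, mul_smul', v_mul_v_self, ← M.ract_mul, v_mul_v_self, smul_smul, smul_smul,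
        mul_assoc x, ← Units.val_mul, ← Units.val_mul, c.σ_cocycle]
    · rw [v_mul_v_of_ne c h', mul_zero, v_mul_v_of_ne c, smul_zero]
      rwa [M.ract_mul]
  · rw [v_mul_v_of_ne c h, zero_mul]
    by_cases h' : M.ract t y = u
    · subst h'
      rw [v_mul_v_self, mul_smul', v_mul_v_of_ne c h, smul_zero]
    · rw [v_mul_v_of_ne c h', mul_zero]

protected theorem mul_assoc (a b d : c.CrossedProduct) : a * b * d = a * (b * d) := by
  induction a using induction_on with
  | zero => simp only [zero_mul]
  | add a a' h h' => simp only [add_mul, h, h']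
  | smul r a h => simp only [smul_mul', h]
  | basis s x =>
    induction b using induction_on with
    | zero => simp only [zero_mul, mul_zero]
    | add a a' h h' => simp only [add_mul, mul_add, h, h']
    | smul r a h => simp only [smul_mul', mul_smul', h]
    | basis t y =>
      induction d using induction_on with
      | zero => simp only [mul_zero]
      | add a a' h h' => simp only [mul_add, h, h']
      | smul r a h => simp only [mul_smul', h]
      | basis u z => exact v_mul_assoc c s t u x y z

theorem v_one_mul_v (s : G) (x : F) : v c s 1 * v c s x = v c s x := by
  have h := v_mul_v_self c s 1 x
  rwa [M.ract_one, c.σ_one_left, Units.val_one, one_smul, one_mul] at h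

theorem v_mul_v_one (s : G) (x : F) : v c s x * v c (M.ract s x) 1 = v c s x := by
  rw [v_mul_v_self, c.σ_one_right, Units.val_one, one_smul, mul_one]

variable [Fintype G]

noncomputable instance : One c.CrossedProduct := ⟨∑ s, v c s 1⟩

theorem one_def : (1 : c.CrossedProduct) = ∑ s, v c s 1 := rfl

theorem sum_smul_v_mul_v (f : G → k) (s : G) (x : F) :
    (∑ t, f t • v c t 1) * v c s x = f s • v c s x := by
  rw [Finset.sum_mul, Finset.sum_eq_single s]
  · rw [smul_mul', v_one_mul_v]
  · intro t _ ht
    rw [smul_mul', v_mul_v_of_ne, smul_zero]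
    rwa [M.ract_one]
  · simp

protected theorem one_mul (a : c.CrossedProduct) : 1 * a = a := by
  induction a using induction_on with
  | zero => exact mul_zero _
  | add a a' h h' => rw [mul_add, h, h']
  | smul r a h => rw [mul_smul', h]
  | basis s x => simpa [one_def] using sum_smul_v_mul_v c (fun _ => 1) s x

protected theorem mul_one (a : c.CrossedProduct) : a * 1 = a := by
  induction a using induction_on with
  | zero => exact zero_mul _
  | add a a' h h' => rw [add_mul, h, h']
  | smul r a h => rw [smul_mul', h]
  | basis s x =>
    rw [one_def, Finset.mul_sum, Finset.sum_eq_single (M.ract s x)]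
    · exact v_mul_v_one c s x
    · intro t _ ht
      exact v_mul_v_of_ne c ht.symm 1
    · simp

noncomputable instance : Ring c.CrossedProduct where
  __ := (inferInstance : NonUnitalNonAssocRing c.CrossedProduct)
  one := 1
  mul_assoc := CrossedProduct.mul_assoc c
  one_mul := CrossedProduct.one_mul c
  mul_one := CrossedProduct.mul_one c

noncomputable instance : Algebra k c.CrossedProduct :=
  Algebra.ofModule (smul_mul' c) (mul_smul' c)

/-! The coalgebra structure. -/

/-- The coproduct. -/
noncomputable def comulLin : c.CrossedProduct →ₗ[k] c.CrossedProduct ⊗[k] c.CrossedProduct :=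
  lift c fun s x => ∑ a, (c.τ a (a⁻¹ * s) x : k) •
    (v c a (M.lact (a⁻¹ * s) x) ⊗ₜ[k] v c (a⁻¹ * s) x)

theorem comulLin_v (s : G) (x : F) : comulLin c (v c s x) = ∑ a, (c.τ a (a⁻¹ * s) x : k) •
    (v c a (M.lact (a⁻¹ * s) x) ⊗ₜ[k] v c (a⁻¹ * s) x) := lift_v c _ s x

open Classical in
/-- The counit. -/
noncomputable def counitLin : c.CrossedProduct →ₗ[k] k :=
  lift c fun s _ => if s = 1 then 1 else 0

open Classical in
theorem counitLin_v (s : G) (x : F) : counitLin c (v c s x) = if s = 1 then 1 else 0 :=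
  lift_v c _ s x

theorem coassoc_v (s : G) (x : F) :
    TensorProduct.assoc k c.CrossedProduct c.CrossedProduct c.CrossedProduct
      ((comulLin c).rTensor _ (comulLin c (v c s x))) =
      (comulLin c).lTensor _ (comulLin c (v c s x)) := by
  simp only [comulLin_v, map_sum, map_smul, LinearMap.rTensor_tmul, LinearMap.lTensor_tmul,
    TensorProduct.sum_tmul, TensorProduct.tmul_sum, TensorProduct.smul_tmul', Finset.smul_sum,
    TensorProduct.assoc_tmul]
  rw [Finset.sum_comm]
  refine Finset.sum_congr rfl fun b _ => ?_
  -- Both sides run over factorizations s = b · (b⁻¹a) · (a⁻¹s); the second sum is indexed by the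
  -- middle factor.
  refine Fintype.sum_equiv (Equiv.mulLeft b⁻¹) _ _ fun a => ?_
  have h := c.τ_cocycle b (b⁻¹ * a) (a⁻¹ * s) x
  have e1 : b⁻¹ * a * (a⁻¹ * s) = b⁻¹ * s := by group
  have e2 : (b⁻¹ * a)⁻¹ * (b⁻¹ * s) = a⁻¹ * s := by group
  rw [mul_inv_cancel_left, e1] at h
  simp only [Equiv.coe_mulLeft, e2, ← M.mul_lact, e1, smul_smul,
    ← TensorProduct.smul_tmul', TensorProduct.tmul_smul]
  rw [← Units.val_mul, ← Units.val_mul, mul_comm, h, mul_comm]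

noncomputable instance : Coalgebra k c.CrossedProduct where
  comul := comulLin c
  counit := counitLin c
  coassoc := linearMap_ext c (coassoc_v c)
  rTensor_counit_comp_comul := linearMap_ext c fun s x => by
    rw [LinearMap.comp_apply, comulLin_v, map_sum, Finset.sum_eq_single 1]
    · rw [map_smul, LinearMap.rTensor_tmul, counitLin_v, if_pos rfl, c.τ_one_left]
      simp
    · intro a _ ha
      rw [map_smul, LinearMap.rTensor_tmul, counitLin_v, if_neg ha, TensorProduct.zero_tmul,
        smul_zero]
    · simp
  lTensor_counit_comp_comul := linearMap_ext c fun s x => by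
    rw [LinearMap.comp_apply, comulLin_v, map_sum, Finset.sum_eq_single s]
    · rw [map_smul, LinearMap.lTensor_tmul, counitLin_v, if_pos (inv_mul_cancel s),
        inv_mul_cancel, c.τ_one_right, M.one_lact]
      simp
    · intro a _ ha
      rw [map_smul, LinearMap.lTensor_tmul, counitLin_v,
        if_neg fun h => ha (inv_mul_eq_one.1 h), TensorProduct.tmul_zero, smul_zero]
    · simp

theorem comul_v (s : G) (x : F) : Coalgebra.comul (R := k) (v c s x) =
    ∑ a, (c.τ a (a⁻¹ * s) x : k) •
      (v c a (M.lact (a⁻¹ * s) x) ⊗ₜ[k] v c (a⁻¹ * s) x) := comulLin_v c s x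

open Classical in
theorem counit_v (s : G) (x : F) :
    Coalgebra.counit (R := k) (v c s x) = if s = 1 then 1 else 0 := counitLin_v c s x

/-! The bialgebra structure. -/

theorem counit_one : Coalgebra.counit (R := k) (1 : c.CrossedProduct) = 1 := by
  classical
  simp [one_def, counit_v]

theorem counit_v_mul_v (s t : G) (x y : F) : Coalgebra.counit (R := k) (v c s x * v c t y) =
    Coalgebra.counit (R := k) (v c s x) * Coalgebra.counit (R := k) (v c t y) := by
  classical
  rw [v_mul_v, counit_v, counit_v]
  by_cases hs : s = 1
  · subst hs
    by_cases ht : t = 1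
    · subst ht
      rw [if_pos (M.one_ract x), c.σ_one, Units.val_one, one_smul, counit_v]
      simp
    · rw [if_neg ht, M.one_ract, if_neg (Ne.symm ht), map_zero, mul_zero]
  · rw [if_neg hs, zero_mul]
    split_ifs
    · rw [map_smul, counit_v, if_neg hs, smul_zero]
    · exact map_zero _

theorem comul_one : Coalgebra.comul (R := k) (1 : c.CrossedProduct) = 1 := by
  rw [one_def, map_sum, Algebra.TensorProduct.one_def, one_def]
  simp only [comul_v, c.τ_one, Units.val_one, one_smul, M.lact_one, TensorProduct.sum_tmul,
    TensorProduct.tmul_sum]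
  rw [Finset.sum_comm]
  conv_rhs => rw [Finset.sum_comm]
  refine Finset.sum_congr rfl fun a _ => ?_
  exact Fintype.sum_equiv (Equiv.mulLeft a⁻¹) _ _ fun s => rfl

/-- For each factorization of s exactly one factorization of s ◁ x gives composable first tensor
factors, and the second factors are then composable by `mul_ract`. Equality of the scalars is the
compatibility condition. -/
theorem comul_v_mul_v_self (s : G) (x y : F) :
    Coalgebra.comul (R := k) (v c s x * v c (M.ract s x) y) =
      Coalgebra.comul (R := k) (v c s x) * Coalgebra.comul (R := k) (v c (M.ract s x) y) := by
  rw [v_mul_v_self, map_smul, comul_v, comul_v, comul_v, Finset.smul_sum, Finset.sum_mul_sum]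
  refine Finset.sum_congr rfl fun a _ => ?_
  have e : (M.ract a (M.lact (a⁻¹ * s) x))⁻¹ * M.ract s x = M.ract (a⁻¹ * s) x := by
    rw [inv_mul_eq_iff_eq_mul, ← M.mul_ract, mul_inv_cancel_left]
  rw [Finset.sum_eq_single (M.ract a (M.lact (a⁻¹ * s) x))]
  · rw [e, smul_mul_smul_comm, Algebra.TensorProduct.tmul_mul_tmul, v_mul_v_self, v_mul_v_self,
      TensorProduct.smul_tmul_smul, smul_smul, smul_smul, ← M.lact_mul, ← Units.val_mul,
      ← Units.val_mul, ← Units.val_mul, ← Units.val_mul]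
    have h := c.compatible a (a⁻¹ * s) x y
    rw [mul_inv_cancel_left] at h
    rw [h, mul_comm]
  · intro b _ hb
    rw [smul_mul_smul_comm, Algebra.TensorProduct.tmul_mul_tmul, v_mul_v_of_ne c hb.symm,
      TensorProduct.zero_tmul, smul_zero]
  · simp

/-- If both tensor factors of some term were composable, multiplying the two conditions would give s
◁ x = t by `mul_ract`. -/
theorem comul_v_mul_v_of_ne {s t : G} {x : F} (h : M.ract s x ≠ t) (y : F) :
    Coalgebra.comul (R := k) (v c s x) * Coalgebra.comul (R := k) (v c t y) = 0 := by
  rw [comul_v, comul_v, Finset.sum_mul_sum]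
  refine Finset.sum_eq_zero fun a _ => Finset.sum_eq_zero fun b _ => ?_
  rw [smul_mul_smul_comm, Algebra.TensorProduct.tmul_mul_tmul]
  by_cases h1 : M.ract a (M.lact (a⁻¹ * s) x) = b
  · rw [v_mul_v_of_ne c (s := a⁻¹ * s), TensorProduct.tmul_zero, smul_zero]
    intro h2
    apply h
    rw [← h1, eq_inv_mul_iff_mul_eq, ← M.mul_ract, mul_inv_cancel_left] at h2
    exact h2
  · rw [v_mul_v_of_ne c h1, TensorProduct.zero_tmul, smul_zero]

noncomputable instance : Bialgebra k c.CrossedProduct :=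
  Bialgebra.mk' k c.CrossedProduct (counit_one c)
    (by
      intro a b
      induction a using induction_on with
      | zero => simp
      | add a a' h h' => rw [add_mul, map_add, h, h', map_add, add_mul]
      | smul r a h => rw [smul_mul_assoc, map_smul, h, map_smul, smul_mul_assoc]
      | basis s x =>
        induction b using induction_on with
        | zero => simp
        | add a a' h h' => rw [mul_add, map_add, h, h', map_add, mul_add]
        | smul r a h => rw [mul_smul_comm, map_smul, h, map_smul, mul_smul_comm]
        | basis t y => exact counit_v_mul_v c s t x y)
    (comul_one c)
    (by
      intro a b
      induction a using induction_on with
      | zero => simp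
      | add a a' h h' => rw [add_mul, map_add, h, h', map_add, add_mul]
      | smul r a h => rw [smul_mul_assoc, map_smul, h, map_smul, smul_mul_assoc]
      | basis s x =>
        induction b using induction_on with
        | zero => simp
        | add a a' h h' => rw [mul_add, map_add, h, h', map_add, mul_add]
        | smul r a h => rw [mul_smul_comm, map_smul, h, map_smul, mul_smul_comm]
        | basis t y =>
          by_cases h : M.ract s x = t
          · subst h
            exact comul_v_mul_v_self c s x y
          · rw [comul_v_mul_v_of_ne c h, v_mul_v_of_ne c h, map_zero])

end CrossedProduct
end CocyclePair

/-! ### The antipode and the extension structure of the crossed product -/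

namespace MatchedPair

variable {G F : Type u} [Group G] [Group F] (M : MatchedPair G F)

/-- The permutation `s ↦ s ◁ x` of `G`. -/
def ractEquiv (x : F) : G ≃ G where
  toFun s := M.ract s x
  invFun s := M.ract s x⁻¹
  left_inv s := M.ract_ract_inv s x
  right_inv s := M.ract_inv_ract s x

theorem ract_inv_lact_inv (s : G) (x : F) :
    M.ract (M.ract s x)⁻¹ (M.lact s x)⁻¹ = s⁻¹ := by
  rw [M.ract_inv, M.ract_ract_inv]

end MatchedPair

namespace CocyclePair

variable {k G F : Type u} [Field k] [Group G] [Group F] {M : MatchedPair G F}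
variable (c : CocyclePair k M)

/-- The cocycle identity at x, x⁻¹, x. With `τ_inv_left` it lets one coefficient serve for both the
left and the right antipode identity. -/
theorem σ_inv_right (s : G) (x : F) : c.σ s x x⁻¹ = c.σ (M.ract s x) x⁻¹ x := by
  have h := c.σ_cocycle s x x⁻¹ x
  rw [inv_mul_cancel, mul_inv_cancel, c.σ_one_left, c.σ_one_right, mul_one, mul_one] at h
  exact h.symm

theorem τ_inv_left (s : G) (x : F) : c.τ s⁻¹ s x = c.τ s s⁻¹ (M.lact s x) := by
  have h := c.τ_cocycle s s⁻¹ s x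
  rw [inv_mul_cancel, mul_inv_cancel, c.τ_one_left, c.τ_one_right, mul_one, mul_one] at h
  exact h.symm

namespace CrossedProduct

variable [Fintype G]

/-- The coefficient of the antipode. -/
def antipodeCoeff (s : G) (x : F) : kˣ :=
  (c.τ s s⁻¹ (M.lact s x) * c.σ (M.ract s x)⁻¹ (M.lact s x)⁻¹ (M.lact s x))⁻¹

/-- The antipode. -/
noncomputable def antipodeLin : c.CrossedProduct →ₗ[k] c.CrossedProduct :=
  lift c fun s x => (antipodeCoeff c s x : k) • v c (M.ract s x)⁻¹ (M.lact s x)⁻¹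

theorem antipodeLin_v (s : G) (x : F) : antipodeLin c (v c s x) =
    (antipodeCoeff c s x : k) • v c (M.ract s x)⁻¹ (M.lact s x)⁻¹ := lift_v c _ s x

/-- For s = 1 the coefficient of the antipode is exactly what cancels τ and σ term by term, and the
remaining idempotents are permuted by s ↦ s ◁ x. For s ≠ 1 no product is composable. -/
theorem antipode_left_v (s : G) (x : F) :
    LinearMap.mul' k c.CrossedProduct ((antipodeLin c).rTensor _ (Coalgebra.comul (v c s x))) =
      algebraMap k c.CrossedProduct (Coalgebra.counit (v c s x)) := by
  classical
  rw [comul_v, counit_v]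
  simp only [map_sum, map_smul, LinearMap.rTensor_tmul, antipodeLin_v, LinearMap.mul'_apply,
    ← M.mul_lact, mul_inv_cancel_left, smul_mul_assoc]
  have hr : ∀ a, M.ract (M.ract a (M.lact (a⁻¹ * s) x))⁻¹ (M.lact s x)⁻¹ = a⁻¹ := fun a => by
    have h := M.ract_inv_lact_inv a (M.lact (a⁻¹ * s) x)
    rwa [← M.mul_lact, mul_inv_cancel_left] at h
  by_cases hs : s = 1
  · subst hs
    rw [if_pos rfl, map_one, one_def]
    refine Fintype.sum_equiv ((Equiv.inv G).trans (M.ractEquiv x)) _ _ fun a => ?_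
    have e : (M.ract a (M.lact a⁻¹ x))⁻¹ = M.ract a⁻¹ x := by
      rw [M.ract_inv, M.lact_lact_inv]
    have h := hr a
    rw [mul_one, e, M.one_lact] at h
    have h1 := v_mul_v_self c (M.ract a⁻¹ x) x⁻¹ x
    rw [h] at h1
    rw [mul_one, e, M.one_lact, h1, smul_smul, smul_smul, inv_mul_cancel, antipodeCoeff, e,
      M.lact_lact_inv, ← Units.val_mul, ← Units.val_mul, mul_right_comm, mul_inv_cancel,
      Units.val_one, one_smul]
    rfl
  · rw [if_neg hs, map_zero]
    refine Finset.sum_eq_zero fun a _ => ?_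
    rw [v_mul_v_of_ne, smul_zero, smul_zero]
    rw [hr]
    exact fun h => hs (left_eq_mul.1 h)

theorem antipode_right_v (s : G) (x : F) :
    LinearMap.mul' k c.CrossedProduct ((antipodeLin c).lTensor _ (Coalgebra.comul (v c s x))) =
      algebraMap k c.CrossedProduct (Coalgebra.counit (v c s x)) := by
  classical
  rw [comul_v, counit_v]
  simp only [map_sum, map_smul, LinearMap.lTensor_tmul, antipodeLin_v, LinearMap.mul'_apply,
    mul_smul_comm]
  by_cases hs : s = 1
  · subst hs
    rw [if_pos rfl, map_one, one_def]
    refine Finset.sum_congr rfl fun a _ => ?_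
    have e : (M.ract a⁻¹ x)⁻¹ = M.ract a (M.lact a⁻¹ x) := by
      rw [M.ract_inv, inv_inv]
    have h1 := c.σ_inv_right a (M.lact a⁻¹ x)
    have h2 := c.τ_inv_left a⁻¹ x
    rw [inv_inv] at h2
    rw [mul_one, e, v_mul_v_self, smul_smul, smul_smul, mul_inv_cancel, antipodeCoeff, e,
      ← h1, inv_inv, ← h2, ← Units.val_mul, ← Units.val_mul, mul_right_comm, mul_inv_cancel,
      Units.val_one, one_smul]
  · rw [if_neg hs, map_zero]
    refine Finset.sum_eq_zero fun a _ => ?_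
    rw [v_mul_v_of_ne, smul_zero, smul_zero]
    rw [M.ract_inv]
    intro h
    have h3 : a = (a⁻¹ * s)⁻¹ := (M.ractEquiv _).injective h
    rw [mul_inv_rev, inv_inv, right_eq_mul, inv_eq_one] at h3
    exact hs h3

noncomputable instance : HopfAlgebra k c.CrossedProduct where
  antipode := antipodeLin c
  mul_antipode_rTensor_comul := linearMap_ext c (antipode_left_v c)
  mul_antipode_lTensor_comul := linearMap_ext c (antipode_right_v c)

/-! The extension. -/

/-- The inclusion of `k^G`, as a linear map. -/
noncomputable def inclLin : FunctionAlgebra k G →ₗ[k] c.CrossedProduct where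
  toFun f := ∑ s, f s • v c s 1
  map_add' f g := by simp [add_smul, Finset.sum_add_distrib]
  map_smul' r f := by simp [Finset.smul_sum, smul_smul]

theorem inclLin_apply (f : FunctionAlgebra k G) : inclLin c f = ∑ s, f s • v c s 1 := rfl

theorem inclLin_e (s : G) : inclLin c (FunctionAlgebra.e k s) = v c s 1 := by
  classical
  simp [inclLin_apply, FunctionAlgebra.e_apply]

theorem inclLin_mul_v (f : FunctionAlgebra k G) (s : G) (x : F) :
    inclLin c f * v c s x = f s • v c s x := sum_smul_v_mul_v c f s x

/-- The inclusion of `k^G`. -/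
noncomputable def incl : FunctionAlgebra k G →ₐc[k] c.CrossedProduct :=
  BialgHom.ofAlgHom
    (AlgHom.ofLinearMap (inclLin c) (by simp [inclLin_apply, one_def])
      (fun f g => by
        rw [inclLin_apply c g, Finset.mul_sum, inclLin_apply]
        refine Finset.sum_congr rfl fun s _ => ?_
        rw [mul_smul_comm, inclLin_mul_v, smul_smul, FunctionAlgebra.mul_apply, mul_comm]))
    (AlgHom.toLinearMap_injective (FunctionAlgebra.linearMap_ext fun s => by
      classical
      change Coalgebra.counit (R := k) (inclLin c (FunctionAlgebra.e k s)) =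
        Coalgebra.counit (R := k) (FunctionAlgebra.e k s)
      rw [inclLin_e, counit_v, FunctionAlgebra.counit_apply, FunctionAlgebra.e_apply]
      simp only [eq_comm]))
    (AlgHom.toLinearMap_injective (FunctionAlgebra.linearMap_ext fun s => by
      change TensorProduct.map (inclLin c) (inclLin c)
        (Coalgebra.comul (R := k) (FunctionAlgebra.e k s)) =
        Coalgebra.comul (R := k) (inclLin c (FunctionAlgebra.e k s))
      rw [inclLin_e, comul_v, FunctionAlgebra.comul_e, map_sum]
      refine Finset.sum_congr rfl fun a _ => ?_
      rw [TensorProduct.map_tmul, inclLin_e, inclLin_e, c.τ_one, M.lact_one, Units.val_one,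
        one_smul]))

theorem incl_apply (f : FunctionAlgebra k G) : incl c f = ∑ s, f s • v c s 1 := rfl

theorem incl_e (s : G) : incl c (FunctionAlgebra.e k s) = v c s 1 := inclLin_e c s

open Classical in
/-- The projection to `kF`, as a linear map. -/
noncomputable def projLin : c.CrossedProduct →ₗ[k] MonoidAlgebra k F :=
  lift c fun s x => if s = 1 then MonoidAlgebra.single x 1 else 0

open Classical in
theorem projLin_v (s : G) (x : F) :
    projLin c (v c s x) = if s = 1 then MonoidAlgebra.single x 1 else 0 := lift_v c _ s x

theorem projLin_v_mul_v (s t : G) (x y : F) :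
    projLin c (v c s x * v c t y) = projLin c (v c s x) * projLin c (v c t y) := by
  classical
  rw [v_mul_v, projLin_v, projLin_v]
  by_cases hs : s = 1
  · subst hs
    by_cases ht : t = 1
    · subst ht
      rw [if_pos (M.one_ract x), c.σ_one, Units.val_one, one_smul, projLin_v, if_pos rfl,
        if_pos rfl, if_pos rfl, MonoidAlgebra.single_mul_single, one_mul]
    · rw [if_neg ht, M.one_ract, if_neg (Ne.symm ht), map_zero, mul_zero]
  · rw [if_neg hs, zero_mul]
    split_ifs
    · rw [map_smul, projLin_v, if_neg hs, smul_zero]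
    · exact map_zero _

theorem coaction_v (s : G) (x : F) :
    (projLin c).lTensor _ (Coalgebra.comul (R := k) (v c s x)) =
      v c s x ⊗ₜ[k] MonoidAlgebra.single x 1 := by
  classical
  rw [comul_v, map_sum, Finset.sum_eq_single s]
  · rw [inv_mul_cancel, map_smul, LinearMap.lTensor_tmul, projLin_v, if_pos rfl, c.τ_one_right,
      M.one_lact, Units.val_one, one_smul]
  · intro a _ ha
    rw [map_smul, LinearMap.lTensor_tmul, projLin_v, if_neg fun h => ha (inv_mul_eq_one.1 h),
      TensorProduct.tmul_zero, smul_zero]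
  · simp

/-- The projection to `kF`. -/
noncomputable def proj : c.CrossedProduct →ₐc[k] MonoidAlgebra k F :=
  BialgHom.ofAlgHom
    (AlgHom.ofLinearMap (projLin c)
      (by
        classical
        simp [one_def, projLin_v, MonoidAlgebra.one_def])
      (fun a b => by
        induction a using induction_on with
        | zero => simp
        | add a a' h h' => rw [add_mul, map_add, h, h', map_add, add_mul]
        | smul r a h => rw [smul_mul_assoc, map_smul, h, map_smul, smul_mul_assoc]
        | basis s x =>
          induction b using induction_on with
          | zero => simp
          | add a a' h h' => rw [mul_add, map_add, h, h', map_add, mul_add]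
          | smul r a h => rw [mul_smul_comm, map_smul, h, map_smul, mul_smul_comm]
          | basis t y => exact projLin_v_mul_v c s t x y))
    (AlgHom.toLinearMap_injective (linearMap_ext c fun s x => by
      classical
      change Coalgebra.counit (R := k) (projLin c (v c s x)) =
        Coalgebra.counit (R := k) (v c s x)
      rw [projLin_v, counit_v]
      split_ifs <;> simp))
    (AlgHom.toLinearMap_injective (linearMap_ext c fun s x => by
      classical
      change TensorProduct.map (projLin c) (projLin c) (Coalgebra.comul (R := k) (v c s x)) =
        Coalgebra.comul (R := k) (projLin c (v c s x))
      rw [← LinearMap.rTensor_comp_lTensor, LinearMap.comp_apply, coaction_v,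
        LinearMap.rTensor_tmul, projLin_v]
      split_ifs <;> simp))

open Classical in
theorem proj_v (s : G) (x : F) :
    proj c (v c s x) = if s = 1 then MonoidAlgebra.single x 1 else 0 := projLin_v c s x

theorem incl_injective : Function.Injective (incl c) := by
  intro f g h
  ext s
  have h1 : inclLin c f * v c s 1 = inclLin c g * v c s 1 := congrArg (· * v c s 1) h
  rw [inclLin_mul_v, inclLin_mul_v] at h1
  exact smul_left_injective k ((basis c).ne_zero (s, 1)) h1

theorem proj_surjective : Function.Surjective (proj c) := by
  classical
  let g : MonoidAlgebra k F →ₗ[k] c.CrossedProduct :=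
    Finsupp.linearCombination k (fun x => v c 1 x) ∘ₗ
      (MonoidAlgebra.coeffLinearEquiv k).toLinearMap
  have h : projLin c ∘ₗ g = LinearMap.id := by
    ext x
    simp [g, projLin_v]
  exact fun a => ⟨g a, LinearMap.congr_fun h a⟩

theorem coaction_incl (f : FunctionAlgebra k G) :
    (projLin c).lTensor _ (Coalgebra.comul (R := k) (incl c f)) = incl c f ⊗ₜ[k] 1 := by
  rw [incl_apply, map_sum, map_sum, TensorProduct.sum_tmul]
  refine Finset.sum_congr rfl fun s _ => ?_
  rw [map_smul, map_smul, coaction_v, TensorProduct.smul_tmul', MonoidAlgebra.one_def]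

/-- The coaction grades the crossed product by F, and the coinvariants are the component of degree
1, spanned by the e_s # 1. -/
theorem mem_range_incl (a : c.CrossedProduct) : a ∈ Set.range (incl c) ↔
    (projLin c).lTensor _ (Coalgebra.comul (R := k) a) = a ⊗ₜ[k] 1 := by
  classical
  constructor
  · rintro ⟨f, rfl⟩
    exact coaction_incl c f
  · intro h
    let ev : MonoidAlgebra k F →ₗ[k] k :=
      Finsupp.lapply 1 ∘ₗ (MonoidAlgebra.coeffLinearEquiv k).toLinearMap
    -- Taking the coefficient of 1 in the kF-leg of the coaction projects onto degree 1, hence into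
    -- the image of k^G; it fixes a coinvariant element.
    let L : c.CrossedProduct →ₗ[k] c.CrossedProduct :=
      (TensorProduct.rid k c.CrossedProduct).toLinearMap ∘ₗ ev.lTensor _ ∘ₗ
        (projLin c).lTensor _ ∘ₗ Coalgebra.comul
    let r : c.CrossedProduct →ₗ[k] FunctionAlgebra k G :=
      lift c fun s x => if x = 1 then FunctionAlgebra.e k s else 0
    have h1 : L = inclLin c ∘ₗ r := linearMap_ext c fun s x => by
      simp only [L, r, ev, LinearMap.comp_apply, coaction_v, lift_v, LinearMap.lTensor_tmul]
      by_cases hx : x = 1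
      · simp [hx, inclLin_e]
      · simp [hx]
    have h2 := LinearMap.congr_fun h1 a
    have h3 : L a = a := by
      simp [L, h, ev, MonoidAlgebra.one_def]
    exact ⟨r a, h2.symm.trans h3⟩

instance [Finite F] : FiniteDimensional k c.CrossedProduct := Module.Finite.of_basis (basis c)

/-- The crossed product as an extension of `kF` by `k^G`. -/
noncomputable def extension [Finite F] : HopfExtension k G F where
  A := c.CrossedProduct
  i := incl c
  π := proj c
  i_injective := incl_injective c
  π_surjective := proj_surjective c
  mem_range_i := mem_range_incl c

theorem isCrossedBasis [Finite F] : IsCrossedBasis c (extension c) (basis c) where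
  mul s x t y := v_mul_v c s t x y
  comul s x := comul_v c s x
  i_e s := incl_e c s
  π_v s x := proj_v c s x

end CrossedProduct

/-- The crossed product as an abelian extension. -/
noncomputable def abelianExtension [Fintype G] [Finite F] : AbelianExtension k M where
  toHopfExtension := CrossedProduct.extension c
  isCrossed := ⟨c, CrossedProduct.basis c, CrossedProduct.isCrossedBasis c⟩

end CocyclePair

/-! ### Extensions are classified by their cocycles -/

section Classification

variable {k G F : Type u} [Field k] [Group G] [Fintype G] [Group F] {M : MatchedPair G F}

/-- Different a give different basis vectors of A ⊗ A, so the values of τ can be read off from a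
coproduct. -/
theorem comul_coeff_injective {A : Type*} [AddCommGroup A] [Module k A]
    (v : Module.Basis (G × F) k A) (s : G) (x : F) {α β : G → k}
    (h : ∑ a, α a • (v (a, M.lact (a⁻¹ * s) x) ⊗ₜ[k] v (a⁻¹ * s, x)) =
      ∑ a, β a • (v (a, M.lact (a⁻¹ * s) x) ⊗ₜ[k] v (a⁻¹ * s, x))) (a : G) : α a = β a := by
  have hinj : Function.Injective fun a : G => ((a, M.lact (a⁻¹ * s) x), (a⁻¹ * s, x)) :=
    fun a b e => congrArg (fun p : (G × F) × (G × F) => p.1.1) e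
  have h1 := (v.tensorProduct v).linearIndependent.comp _ hinj
  have h2 := Fintype.linearIndependent_iff.1 h1 (fun a => α a - β a) (by
    simp only [Function.comp_apply, Module.Basis.tensorProduct_apply, sub_smul,
      Finset.sum_sub_distrib]
    rw [h, sub_self]) a
  exact sub_eq_zero.1 h2

namespace IsCrossedBasis

variable {c c' : CocyclePair k M} {E E' : HopfExtension k G F}
  {v : Module.Basis (G × F) k E.A} {v' : Module.Basis (G × F) k E'.A}

theorem one_eq (hv : IsCrossedBasis c E v) : (1 : E.A) = ∑ s, v (s, 1) := by
  rw [← map_one E.i, ← FunctionAlgebra.sum_e, map_sum]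
  exact Finset.sum_congr rfl fun s _ => hv.i_e s

open Classical in
theorem counit_eq (hv : IsCrossedBasis c E v) (s : G) (x : F) :
    Coalgebra.counit (R := k) (v (s, x)) = if s = 1 then 1 else 0 := by
  have h : Coalgebra.counit (R := k) (E.π (v (s, x))) = Coalgebra.counit (R := k) (v (s, x)) :=
    CoalgHomClass.counit_comp_apply E.π _
  rw [← h, hv.π_v]
  split_ifs <;> simp

theorem mul_self (hv : IsCrossedBasis c E v) (s : G) (x y : F) :
    v (s, x) * v (M.ract s x, y) = (c.σ s x y : k) • v (s, x * y) := by
  rw [hv.mul, if_pos rfl]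

theorem mul_of_ne (hv : IsCrossedBasis c E v) {s t : G} {x : F} (h : M.ract s x ≠ t) (y : F) :
    v (s, x) * v (t, y) = 0 := by
  rw [hv.mul, if_neg h]

/-- The cochain is the family of diagonal entries of `f`: π and i force its two normalizations,
multiplicativity gives the formula for σ, and comultiplicativity the one for τ. -/
theorem div_mem_coboundaries (hv : IsCrossedBasis c E v) (hv' : IsCrossedBasis c' E' v')
    (f : E.A →ₐc[k] E'.A) (hi : f.comp E.i = E'.i) (hπ : E'.π.comp f = E.π) :
    c / c' ∈ CocyclePair.coboundaries k M := by
  choose r hr using HopfExtension.exists_unit_smul hv hv' f hi hπ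
  refine ⟨r, fun x => ?_, fun s => ?_, fun s x y => ?_, fun s t x => ?_⟩
  · have h1 : E'.π (f (v (1, x))) = E.π (v (1, x)) := by
      rw [← hπ]
      rfl
    rw [hr, map_smul, hv'.π_v, hv.π_v, if_pos rfl] at h1
    have h2 := congrArg (fun a : MonoidAlgebra k F => a.coeff x) h1
    simpa using h2
  · have h1 : f (v (s, 1)) = v' (s, 1) := by
      rw [← hv.i_e, ← hv'.i_e, ← hi]
      rfl
    rw [hr] at h1
    have h2 : (r s 1 : k) • v' (s, 1) = (1 : k) • v' (s, 1) := by rw [h1, one_smul]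
    exact Units.ext (smul_left_injective k (v'.ne_zero _) h2)
  · have h1 := congrArg f (hv.mul_self s x y)
    rw [map_mul, hr, hr, map_smul, hr, smul_mul_smul_comm, hv'.mul_self, smul_smul, smul_smul]
      at h1
    have h2 := smul_left_injective k (v'.ne_zero _) h1
    rw [← Units.val_mul, ← Units.val_mul, ← Units.val_mul, Units.val_inj] at h2
    change c.σ s x y / c'.σ s x y = _
    rw [div_eq_div_iff_mul_eq_mul, h2, mul_comm]
  · have h1 : TensorProduct.map (f : E.A →ₗ[k] E'.A) (f : E.A →ₗ[k] E'.A)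
        (Coalgebra.comul (v (s * t, x))) = Coalgebra.comul (f (v (s * t, x))) :=
      CoalgHomClass.map_comp_comul_apply f _
    have hf : ∀ s x, (f : E.A →ₗ[k] E'.A) (v (s, x)) = (r s x : k) • v' (s, x) := hr
    rw [hr, map_smul, hv.comul, hv'.comul, map_sum, Finset.smul_sum] at h1
    simp only [map_smul, TensorProduct.map_tmul, hf, TensorProduct.smul_tmul_smul, smul_smul]
      at h1
    have h2 := comul_coeff_injective v' (s * t) x h1 s
    rw [inv_mul_cancel_left, ← Units.val_mul, ← Units.val_mul, ← Units.val_mul, Units.val_inj]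
      at h2
    change c.τ s t x / c'.τ s t x = _
    rw [div_eq_div_iff_mul_eq_mul, h2]

/-- The coboundary formulas are the change of structure constants under this rescaling; the
normalizations of `r` keep the values of i and π. -/
theorem rescale (hv : IsCrossedBasis c E v) {r : G → F → kˣ} (hr : (c / c').IsCoboundaryOf r) :
    IsCrossedBasis c' E (v.unitsSMul fun p => (r p.1 p.2)⁻¹) where
  mul s x t y := by
    simp only [Module.Basis.unitsSMul_apply, Units.smul_def]
    rw [smul_mul_smul_comm]
    by_cases h : M.ract s x = t
    · subst h
      have h1 : c.σ s x y / c'.σ s x y = _ := hr.σ_eq s x y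
      rw [div_eq_div_iff_mul_eq_mul] at h1
      rw [if_pos rfl, hv.mul_self, smul_smul, smul_smul, ← Units.val_mul, ← Units.val_mul,
        ← Units.val_mul]
      congr 2
      rw [← mul_inv, inv_mul_eq_iff_eq_mul, ← mul_assoc, eq_mul_inv_iff_mul_eq, h1, mul_comm]
    · rw [if_neg h, hv.mul_of_ne h, smul_zero]
  comul s x := by
    simp only [Module.Basis.unitsSMul_apply, Units.smul_def]
    rw [map_smul, hv.comul, Finset.smul_sum]
    refine Finset.sum_congr rfl fun a _ => ?_
    have h1 : c.τ a (a⁻¹ * s) x / c'.τ a (a⁻¹ * s) x = _ := hr.τ_eq a (a⁻¹ * s) x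
    rw [mul_inv_cancel_left, div_eq_div_iff_mul_eq_mul] at h1
    rw [TensorProduct.smul_tmul_smul, smul_smul, smul_smul, ← Units.val_mul, ← Units.val_mul,
      ← Units.val_mul]
    congr 2
    rw [← mul_inv, inv_mul_eq_iff_eq_mul, ← mul_assoc, eq_mul_inv_iff_mul_eq, h1]
  i_e s := by
    rw [hv.i_e, Module.Basis.unitsSMul_apply, hr.one_right, inv_one, one_smul]
  π_v s x := by
    rw [Module.Basis.unitsSMul_apply, Units.smul_def, map_smul, hv.π_v]
    split_ifs with h
    · rw [h, hr.one_left, inv_one, Units.val_one, one_smul]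
    · rw [smul_zero]

theorem exists_rescale (hv : IsCrossedBasis c E v) (h : c / c' ∈ CocyclePair.coboundaries k M) :
    ∃ w : Module.Basis (G × F) k E.A, IsCrossedBasis c' E w := by
  obtain ⟨r, hr⟩ := h
  exact ⟨_, hv.rescale hr⟩

theorem equivalent (hv : IsCrossedBasis c E v) (hv' : IsCrossedBasis c E' v') :
    E.Equivalent E' := by
  let L : E.A →ₗ[k] E'.A := v.constr k v'
  have hL : ∀ p, L (v p) = v' p := fun p => v.constr_basis k v' p
  have hmul : ∀ a b, L (a * b) = L a * L b := by
    intro a b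
    induction a using v.induction_on with
    | zero => simp
    | add a a' h h' => rw [add_mul, map_add, h, h', map_add, add_mul]
    | smul r a h => rw [smul_mul_assoc, map_smul, h, map_smul, smul_mul_assoc]
    | basis p =>
      induction b using v.induction_on with
      | zero => simp
      | add a a' h h' => rw [mul_add, map_add, h, h', map_add, mul_add]
      | smul r a h => rw [mul_smul_comm, map_smul, h, map_smul, mul_smul_comm]
      | basis q =>
        obtain ⟨s, x⟩ := p
        obtain ⟨t, y⟩ := q
        rw [hL, hL, hv.mul, hv'.mul]
        split_ifs
        · rw [map_smul, hL]
        · exact map_zero L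
  let f : E.A →ₐc[k] E'.A := BialgHom.ofAlgHom
    (AlgHom.ofLinearMap L (by simp only [hv.one_eq, hv'.one_eq, map_sum, hL]) hmul)
    (AlgHom.toLinearMap_injective (v.ext fun p => by
      change Coalgebra.counit (R := k) (L (v p)) = Coalgebra.counit (R := k) (v p)
      obtain ⟨s, x⟩ := p
      rw [hL, hv.counit_eq, hv'.counit_eq]))
    (AlgHom.toLinearMap_injective (v.ext fun p => by
      change TensorProduct.map L L (Coalgebra.comul (R := k) (v p)) =
        Coalgebra.comul (R := k) (L (v p))
      obtain ⟨s, x⟩ := p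
      rw [hL, hv.comul, hv'.comul]
      simp only [map_sum, map_smul, TensorProduct.map_tmul, hL]))
  have hf : ∀ a, f a = L a := fun _ => rfl
  refine ⟨f, ?_, ?_⟩
  · have h1 : L ∘ₗ (E.i : FunctionAlgebra k G →ₗ[k] E.A) =
        (E'.i : FunctionAlgebra k G →ₗ[k] E'.A) := FunctionAlgebra.linearMap_ext fun s => by
      change L (E.i _) = E'.i _
      rw [hv.i_e, hv'.i_e, hL]
    exact BialgHom.ext fun a => LinearMap.congr_fun h1 a
  · have h1 : (E'.π : E'.A →ₗ[k] MonoidAlgebra k F) ∘ₗ L =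
        (E.π : E.A →ₗ[k] MonoidAlgebra k F) := v.ext fun p => by
      change E'.π (L (v p)) = E.π (v p)
      obtain ⟨s, x⟩ := p
      rw [hL, hv.π_v, hv'.π_v]
    exact BialgHom.ext fun a => LinearMap.congr_fun h1 a

end IsCrossedBasis

/-! ### Opext as the set of cocycle classes -/

namespace Opext

/-- The class of the pair of cocycles of an abelian extension. -/
noncomputable def cocycleClass :
    Opext k M → CocyclePair k M ⧸ CocyclePair.coboundaries k M :=
  Quotient.lift (fun E : AbelianExtension k M => QuotientGroup.mk E.isCrossed.choose) (by
    rintro E E' ⟨f, hi, hπ⟩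
    have h := E.isCrossed.choose_spec.choose_spec.div_mem_coboundaries
      E'.isCrossed.choose_spec.choose_spec f hi hπ
    exact QuotientGroup.eq_iff_div_mem.2 h)

/-- Applying the comparison to the identity map of `E` with two crossed bases shows that the chosen
basis does not matter. -/
theorem cocycleClass_toOpext {E : AbelianExtension k M} {c : CocyclePair k M}
    {v : Module.Basis (G × F) k E.A} (hv : IsCrossedBasis c E.toHopfExtension v) :
    cocycleClass E.toOpext = QuotientGroup.mk c := by
  have h := E.isCrossed.choose_spec.choose_spec.div_mem_coboundaries hv (BialgHom.id k E.A)
    (by ext; rfl) (by ext; rfl)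
  exact QuotientGroup.eq_iff_div_mem.2 h

theorem cocycleClass_injective : Function.Injective (cocycleClass (k := k) (M := M)) := by
  rintro ⟨E⟩ ⟨E'⟩ h
  obtain ⟨c, v, hv⟩ := E.isCrossed
  obtain ⟨c', v', hv'⟩ := E'.isCrossed
  have h1 := (cocycleClass_toOpext hv).symm.trans (h.trans (cocycleClass_toOpext hv'))
  obtain ⟨w, hw⟩ := hv.exists_rescale (QuotientGroup.eq_iff_div_mem.1 h1)
  exact Quotient.sound (hw.equivalent hv')

theorem cocycleClass_surjective [Finite F] :
    Function.Surjective (cocycleClass (k := k) (M := M)) := by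
  rintro ⟨c⟩
  exact ⟨c.abelianExtension.toOpext,
    cocycleClass_toOpext (E := c.abelianExtension) (CocyclePair.CrossedProduct.isCrossedBasis c)⟩

variable (k M) in
/-- Classes of abelian extensions correspond to classes of pairs of cocycles. -/
noncomputable def equivCocycleClass [Finite F] :
    Opext k M ≃ CocyclePair k M ⧸ CocyclePair.coboundaries k M :=
  Equiv.ofBijective cocycleClass ⟨cocycleClass_injective, cocycleClass_surjective⟩

end Opext

end Classification

/-! ### The Baer product multiplies cocycles -/

namespace IsCrossedBasis

variable {k G F : Type u} [Field k] [Group G] [Fintype G] [Group F] {M : MatchedPair G F}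

theorem i_mul {c : CocyclePair k M} {E : HopfExtension k G F} {v : Module.Basis (G × F) k E.A}
    (hv : IsCrossedBasis c E v) (f : FunctionAlgebra k G) (s : G) (x : F) :
    E.i f * v (s, x) = f s • v (s, x) := by
  have h1 : LinearMap.mulRight k (v (s, x)) ∘ₗ (E.i : FunctionAlgebra k G →ₗ[k] E.A) =
      ((FunctionAlgebra.eval s : FunctionAlgebra k G →ₐ[k] k) :
        FunctionAlgebra k G →ₗ[k] k).smulRight (v (s, x)) := by
    refine FunctionAlgebra.linearMap_ext fun t => ?_
    change E.i (FunctionAlgebra.e k t) * v (s, x) = FunctionAlgebra.e k t s • v (s, x)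
    rw [hv.i_e, FunctionAlgebra.e_apply]
    by_cases h : s = t
    · subst h
      have h2 := hv.mul_self s 1 x
      rw [M.ract_one] at h2
      rw [h2, c.σ_one_left, Units.val_one, one_mul, if_pos rfl]
    · rw [if_neg h, zero_smul, hv.mul_of_ne]
      rw [M.ract_one]
      exact Ne.symm h
  exact LinearMap.congr_fun h1 f

/-! ### Cotensor and balanced tensor products in crossed bases -/

section Baer

variable {c₁ c₂ : CocyclePair k M} {E₁ E₂ : HopfExtension k G F}
  {v₁ : Module.Basis (G × F) k E₁.A} {v₂ : Module.Basis (G × F) k E₂.A}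

theorem tmul_mem_cotensor (h₁ : IsCrossedBasis c₁ E₁ v₁) (h₂ : IsCrossedBasis c₂ E₂ v₂)
    (s t : G) (x : F) : v₁ (s, x) ⊗ₜ[k] v₂ (t, x) ∈ E₁.cotensor E₂ := by
  change (TensorProduct.assoc k E₁.A E₂.A (MonoidAlgebra k F)).symm
      (E₂.coaction.lTensor E₁.A (v₁ (s, x) ⊗ₜ[k] v₂ (t, x))) =
    TensorProduct.rightComm k E₁.A (MonoidAlgebra k F) E₂.A
      (E₁.coaction.rTensor E₂.A (v₁ (s, x) ⊗ₜ[k] v₂ (t, x)))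
  rw [LinearMap.lTensor_tmul, LinearMap.rTensor_tmul, h₁.coaction, h₂.coaction,
    TensorProduct.assoc_symm_tmul, TensorProduct.rightComm_tmul]

/-- `A₁ □ A₂` is spanned by the elements `(e_s # x) ⊗ (e_t # x)`. -/
theorem cotensor_eq_span (h₁ : IsCrossedBasis c₁ E₁ v₁) (h₂ : IsCrossedBasis c₂ E₂ v₂) :
    E₁.cotensor E₂ = Submodule.span k
      ((v₁.tensorProduct v₂) '' {p : (G × F) × (G × F) | p.1.2 = p.2.2}) := by
  classical
  apply le_antisymm
  · intro a ha
    rw [Module.Basis.mem_span_image]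
    rintro ⟨⟨s, x⟩, ⟨t, y⟩⟩ hp
    by_contra hxy
    apply Finsupp.mem_support_iff.1 hp
    -- This functional reads the coordinate at ((s, x), (t, y)) in degree y. The coaction of the
    -- second factor returns that coordinate, while that of the first returns zero because x ≠ y; on
    -- the cotensor product the two agree.
    let φ : (E₁.A ⊗[k] E₂.A) ⊗[k] MonoidAlgebra k F →ₗ[k] k :=
      (TensorProduct.rid k k).toLinearMap ∘ₗ
        TensorProduct.map ((v₁.tensorProduct v₂).coord ((s, x), (t, y)))
          (Finsupp.lapply y ∘ₗ (MonoidAlgebra.coeffLinearEquiv k).toLinearMap)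
    have hl : φ ∘ₗ (TensorProduct.assoc k E₁.A E₂.A (MonoidAlgebra k F)).symm.toLinearMap ∘ₗ
        E₂.coaction.lTensor E₁.A = (v₁.tensorProduct v₂).coord ((s, x), (t, y)) := by
      refine (v₁.tensorProduct v₂).ext ?_
      rintro ⟨⟨s', x'⟩, ⟨t', y'⟩⟩
      by_cases h : y' = y
      · subst h
        simp [φ, h₂.coaction, Module.Basis.tensorProduct_apply]
      · simp [φ, h₂.coaction, Module.Basis.tensorProduct_apply, h, Finsupp.single_apply]
    have hr : φ ∘ₗ (TensorProduct.rightComm k E₁.A (MonoidAlgebra k F) E₂.A).toLinearMap ∘ₗ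
        E₁.coaction.rTensor E₂.A = 0 := by
      refine (v₁.tensorProduct v₂).ext ?_
      rintro ⟨⟨s', x'⟩, ⟨t', y'⟩⟩
      by_cases h : x' = y
      · have hx : x ≠ x' := fun e => hxy (e.trans h)
        simp [φ, h₁.coaction, Module.Basis.tensorProduct_apply, Finsupp.single_apply, hx.symm]
      · simp [φ, h₁.coaction, Module.Basis.tensorProduct_apply, h, Finsupp.single_apply]
    have h1 : φ ((TensorProduct.assoc k E₁.A E₂.A (MonoidAlgebra k F)).symm
        (E₂.coaction.lTensor E₁.A a)) = φ (TensorProduct.rightComm k E₁.A (MonoidAlgebra k F) E₂.A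
          (E₁.coaction.rTensor E₂.A a)) := congrArg φ ha
    exact (LinearMap.congr_fun hl a).symm.trans (h1.trans (LinearMap.congr_fun hr a))
  · rw [Submodule.span_le]
    rintro _ ⟨⟨⟨s, x⟩, ⟨t, y⟩⟩, h, rfl⟩
    obtain rfl : x = y := h
    rw [Module.Basis.tensorProduct_apply]
    exact tmul_mem_cotensor h₁ h₂ s t x

theorem cotensor_induction (h₁ : IsCrossedBasis c₁ E₁ v₁) (h₂ : IsCrossedBasis c₂ E₂ v₂)
    {p : ∀ a : E₁.A ⊗[k] E₂.A, a ∈ E₁.cotensor E₂ → Prop} (zero : p 0 (zero_mem _))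
    (add : ∀ a b ha hb, p a ha → p b hb → p (a + b) (add_mem ha hb))
    (smul : ∀ (r : k) a ha, p a ha → p (r • a) (Submodule.smul_mem _ r ha))
    (basis : ∀ s t x, p (v₁ (s, x) ⊗ₜ[k] v₂ (t, x)) (tmul_mem_cotensor h₁ h₂ s t x))
    {a : E₁.A ⊗[k] E₂.A} (ha : a ∈ E₁.cotensor E₂) : p a ha := by
  have hspan := cotensor_eq_span h₁ h₂
  have ha' := ha
  rw [hspan] at ha'
  induction ha' using Submodule.span_induction with
  | mem a h' =>
    obtain ⟨⟨⟨s, x⟩, ⟨t, y⟩⟩, h, rfl⟩ := h'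
    obtain rfl : x = y := h
    simp only [Module.Basis.tensorProduct_apply]
    exact basis s t x
  | zero => exact zero
  | add a b h h' hpa hpb =>
    rw [← hspan] at h h'
    exact add a b h h' (hpa h) (hpb h')
  | smul r a h hpa =>
    rw [← hspan] at h
    exact smul r a h (hpa h)

/-- Moving e_s across the balanced tensor product fixes the left factor and kills the right one. -/
theorem mkQ_tmul_of_ne (h₁ : IsCrossedBasis c₁ E₁ v₁) (h₂ : IsCrossedBasis c₂ E₂ v₂)
    {s t : G} (h : s ≠ t) (x y : F) :
    (E₁.balancing E₂).mkQ (v₁ (s, x) ⊗ₜ[k] v₂ (t, y)) = 0 := by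
  rw [Submodule.mkQ_apply, Submodule.Quotient.mk_eq_zero]
  refine Submodule.subset_span ⟨FunctionAlgebra.e k s, v₁ (s, x), v₂ (t, y), ?_⟩
  rw [h₁.i_mul, h₂.i_mul, FunctionAlgebra.e_apply, FunctionAlgebra.e_apply, if_pos rfl,
    if_neg h.symm, one_smul, zero_smul, TensorProduct.tmul_zero, sub_zero]

variable (v₁ v₂) in
/-- The image of `(e_s # x) ⊗ (e_s # x)` in `A₁ ⊗_{k^G} A₂`. -/
noncomputable def baerVec (p : G × F) : E₁.BalancedTensor E₂ :=
  (E₁.balancing E₂).mkQ (v₁ p ⊗ₜ[k] v₂ p)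

variable (v₁ v₂) in
open Classical in
/-- The coordinates of an element of `A₁ ⊗ A₂` at the vectors `(e_s # x) ⊗ (e_s # x)`. -/
noncomputable def diagCoord : E₁.A ⊗[k] E₂.A →ₗ[k] G × F →₀ k :=
  (v₁.tensorProduct v₂).constr k fun p => if p.1 = p.2 then Finsupp.single p.1 1 else 0

open Classical in
theorem diagCoord_tmul (p q : G × F) :
    diagCoord v₁ v₂ (v₁ p ⊗ₜ[k] v₂ q) = if p = q then Finsupp.single p 1 else 0 := by
  rw [← Module.Basis.tensorProduct_apply]
  exact (v₁.tensorProduct v₂).constr_basis _ _ _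

/-- On a diagonal pair of basis vectors f acts on both factors by the same scalar f(s), so diagonal
coordinates survive in the quotient; this gives the independence of `baerVec`. -/
theorem balancing_le_ker_diagCoord (h₁ : IsCrossedBasis c₁ E₁ v₁)
    (h₂ : IsCrossedBasis c₂ E₂ v₂) : E₁.balancing E₂ ≤ LinearMap.ker (diagCoord v₁ v₂) := by
  classical
  refine Submodule.span_le.2 ?_
  rintro _ ⟨f, a, b, rfl⟩
  change diagCoord v₁ v₂ ((E₁.i f * a) ⊗ₜ[k] b - a ⊗ₜ[k] (E₂.i f * b)) = 0
  rw [map_sub, sub_eq_zero]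
  induction a using v₁.induction_on with
  | zero => simp
  | add a a' h h' => simp only [mul_add, TensorProduct.add_tmul, map_add, h, h']
  | smul r a h => rw [mul_smul_comm, ← TensorProduct.smul_tmul', map_smul, h,
      ← TensorProduct.smul_tmul', map_smul]
  | basis p =>
    induction b using v₂.induction_on with
    | zero => simp
    | add a a' h h' => simp only [mul_add, TensorProduct.tmul_add, map_add, h, h']
    | smul r a h => rw [mul_smul_comm, TensorProduct.tmul_smul, map_smul, h,
        TensorProduct.tmul_smul, map_smul]
    | basis q =>
      obtain ⟨s, x⟩ := p
      obtain ⟨t, y⟩ := q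
      rw [h₁.i_mul, h₂.i_mul, ← TensorProduct.smul_tmul', TensorProduct.tmul_smul, map_smul,
        map_smul, diagCoord_tmul]
      split_ifs with h
      · obtain rfl : s = t := congrArg Prod.fst h
        rfl
      · rw [smul_zero, smul_zero]

/-- The coordinates with respect to the vectors `baerVec`, on all of `A₁ ⊗_{k^G} A₂`. -/
noncomputable def baerCoord (h₁ : IsCrossedBasis c₁ E₁ v₁) (h₂ : IsCrossedBasis c₂ E₂ v₂) :
    E₁.BalancedTensor E₂ →ₗ[k] G × F →₀ k :=
  (E₁.balancing E₂).liftQ (diagCoord v₁ v₂) (balancing_le_ker_diagCoord h₁ h₂)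

theorem baerCoord_mkQ (h₁ : IsCrossedBasis c₁ E₁ v₁) (h₂ : IsCrossedBasis c₂ E₂ v₂)
    (a : E₁.A ⊗[k] E₂.A) :
    baerCoord h₁ h₂ ((E₁.balancing E₂).mkQ a) = diagCoord v₁ v₂ a := rfl

theorem baerCoord_baerVec (h₁ : IsCrossedBasis c₁ E₁ v₁) (h₂ : IsCrossedBasis c₂ E₂ v₂)
    (p : G × F) : baerCoord h₁ h₂ (baerVec v₁ v₂ p) = Finsupp.single p 1 := by
  rw [baerVec, baerCoord_mkQ, diagCoord_tmul, if_pos rfl]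

theorem linearIndependent_baerVec (h₁ : IsCrossedBasis c₁ E₁ v₁) (h₂ : IsCrossedBasis c₂ E₂ v₂) :
    LinearIndependent k (baerVec v₁ v₂) := by
  refine LinearIndependent.of_comp (baerCoord h₁ h₂) ?_
  have h : baerCoord h₁ h₂ ∘ baerVec v₁ v₂ = (Finsupp.basisSingleOne : Module.Basis (G × F) k _) :=
    funext fun p => (baerCoord_baerVec h₁ h₂ p).trans (by simp)
  rw [h]
  exact Module.Basis.linearIndependent _

open Classical in
theorem mkQ_tmul (h₁ : IsCrossedBasis c₁ E₁ v₁) (h₂ : IsCrossedBasis c₂ E₂ v₂) (s t : G) (x : F) :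
    (E₁.balancing E₂).mkQ (v₁ (s, x) ⊗ₜ[k] v₂ (t, x)) =
      if s = t then baerVec v₁ v₂ (s, x) else 0 := by
  split_ifs with h
  · rw [← h, baerVec]
  · exact mkQ_tmul_of_ne h₁ h₂ h x x

theorem map_mkQ_cotensor (h₁ : IsCrossedBasis c₁ E₁ v₁) (h₂ : IsCrossedBasis c₂ E₂ v₂) :
    (E₁.cotensor E₂).map (E₁.balancing E₂).mkQ =
      Submodule.span k (Set.range (baerVec v₁ v₂)) := by
  classical
  apply le_antisymm
  · rintro _ ⟨a, ha, rfl⟩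
    induction ha using cotensor_induction h₁ h₂ with
    | zero => exact zero_mem _
    | add a b _ _ ha hb => exact add_mem ha hb
    | smul r a _ ha => exact Submodule.smul_mem _ r ha
    | basis s t x =>
      rw [mkQ_tmul h₁ h₂]
      split_ifs
      · exact Submodule.subset_span ⟨_, rfl⟩
      · exact zero_mem _
  · rw [Submodule.span_le]
    rintro _ ⟨⟨s, x⟩, rfl⟩
    exact ⟨_, tmul_mem_cotensor h₁ h₂ s s x, rfl⟩

theorem mkQ_mul_baer (h₁ : IsCrossedBasis c₁ E₁ v₁) (h₂ : IsCrossedBasis c₂ E₂ v₂)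
    (s : G) (x y : F) :
    (E₁.balancing E₂).mkQ ((v₁ (s, x) ⊗ₜ[k] v₂ (s, x)) *
      (v₁ (M.ract s x, y) ⊗ₜ[k] v₂ (M.ract s x, y))) =
      ((c₁ * c₂).σ s x y : k) • baerVec v₁ v₂ (s, x * y) := by
  rw [Algebra.TensorProduct.tmul_mul_tmul, h₁.mul_self, h₂.mul_self, TensorProduct.smul_tmul_smul,
    map_smul, baerVec, CocyclePair.mul_σ, Units.val_mul]

open Classical in
-- A term indexed by a and b survives only if a = b and a⁻¹s = b⁻¹t. Hence everything vanishes for s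
-- ≠ t, and for s = t the values of τ multiply.
theorem map_mkQ_comul (h₁ : IsCrossedBasis c₁ E₁ v₁) (h₂ : IsCrossedBasis c₂ E₂ v₂)
    (s t : G) (x : F) :
    TensorProduct.map (E₁.balancing E₂).mkQ (E₁.balancing E₂).mkQ
      (Coalgebra.comul (R := k) (v₁ (s, x) ⊗ₜ[k] v₂ (t, x))) =
      if s = t then ∑ a, ((c₁ * c₂).τ a (a⁻¹ * s) x : k) •
        (baerVec v₁ v₂ (a, M.lact (a⁻¹ * s) x) ⊗ₜ[k] baerVec v₁ v₂ (a⁻¹ * s, x)) else 0 := by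
  rw [TensorProduct.comul_tmul, h₁.comul, h₂.comul]
  simp only [TensorProduct.sum_tmul, TensorProduct.tmul_sum, map_sum,
    TensorProduct.smul_tmul_smul, map_smul]
  have hterm : ∀ a b : G, TensorProduct.map (E₁.balancing E₂).mkQ (E₁.balancing E₂).mkQ
      (TensorProduct.AlgebraTensorModule.tensorTensorTensorComm k k k k E₁.A E₁.A E₂.A E₂.A
        ((v₁ (a, M.lact (a⁻¹ * s) x) ⊗ₜ[k] v₁ (a⁻¹ * s, x)) ⊗ₜ[k]
          (v₂ (b, M.lact (b⁻¹ * t) x) ⊗ₜ[k] v₂ (b⁻¹ * t, x)))) =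
      if a = b then if s = t then
        baerVec v₁ v₂ (a, M.lact (a⁻¹ * s) x) ⊗ₜ[k] baerVec v₁ v₂ (a⁻¹ * s, x) else 0 else 0 := by
    intro a b
    rw [TensorProduct.AlgebraTensorModule.tensorTensorTensorComm_tmul, TensorProduct.map_tmul]
    by_cases hab : a = b
    · subst hab
      rw [if_pos rfl, mkQ_tmul h₁ h₂]
      by_cases hst : s = t
      · subst hst
        rw [if_pos rfl, if_pos rfl]
        rfl
      · rw [if_neg hst, if_neg (fun h => hst (mul_left_cancel h)), TensorProduct.tmul_zero]
    · rw [if_neg hab, mkQ_tmul_of_ne h₁ h₂ hab, TensorProduct.zero_tmul]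
  simp only [hterm]
  split_ifs with hst
  · subst hst
    refine Finset.sum_congr rfl fun a _ => ?_
    rw [Finset.sum_eq_single a, if_pos rfl, CocyclePair.mul_τ, Units.val_mul]
    · intro b _ hb
      rw [if_neg hb, smul_zero]
    · simp
  · simp

theorem mkQ_i_tmul_one (h₁ : IsCrossedBasis c₁ E₁ v₁) (h₂ : IsCrossedBasis c₂ E₂ v₂) (s : G) :
    (E₁.balancing E₂).mkQ (E₁.i (FunctionAlgebra.e k s) ⊗ₜ[k] 1) = baerVec v₁ v₂ (s, 1) := by
  classical
  rw [h₁.i_e, h₂.one_eq, TensorProduct.tmul_sum, map_sum]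
  simp only [mkQ_tmul h₁ h₂]
  simp

open Classical in
theorem rid_map_π_counit (h₁ : IsCrossedBasis c₁ E₁ v₁) (h₂ : IsCrossedBasis c₂ E₂ v₂)
    (s t : G) (x : F) :
    TensorProduct.rid k (MonoidAlgebra k F)
      (TensorProduct.map (E₁.π : E₁.A →ₗ[k] MonoidAlgebra k F)
        (Coalgebra.counit : E₂.A →ₗ[k] k) (v₁ (s, x) ⊗ₜ[k] v₂ (t, x))) =
      if s = t then if s = 1 then MonoidAlgebra.single x 1 else 0 else 0 := by
  have hπ : (E₁.π : E₁.A →ₗ[k] MonoidAlgebra k F) (v₁ (s, x)) = E₁.π (v₁ (s, x)) := rfl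
  rw [TensorProduct.map_tmul, hπ, h₁.π_v, h₂.counit_eq, TensorProduct.rid_tmul]
  by_cases hs : s = 1
  · subst hs
    by_cases ht : t = 1
    · subst ht
      simp
    · rw [if_neg ht, zero_smul, if_neg (Ne.symm ht)]
  · simp [hs]

variable {E : HopfExtension k G F} {v : Module.Basis (G × F) k E.A}

theorem isBaerProduct (h₁ : IsCrossedBasis c₁ E₁ v₁) (h₂ : IsCrossedBasis c₂ E₂ v₂)
    (h : IsCrossedBasis (c₁ * c₂) E v) : HopfExtension.IsBaerProduct E₁ E₂ E := by
  classical
  let j : E.A →ₗ[k] E₁.BalancedTensor E₂ := v.constr k (baerVec v₁ v₂)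
  have hj : ∀ p, j (v p) = baerVec v₁ v₂ p := fun p => v.constr_basis k _ p
  have hcoord : ∀ a, baerCoord h₁ h₂ (j a) = v.repr a := fun a => by
    have h1 : baerCoord h₁ h₂ ∘ₗ j = v.repr.toLinearMap := v.ext fun p => by
      rw [LinearMap.comp_apply, hj, baerCoord_baerVec]
      simp
    exact LinearMap.congr_fun h1 a
  -- A linear recovery of `a` from any representative of `j a`. Replacing `a` by `l t` makes the
  -- remaining conditions linear in the representatives, so they can be checked on the spanning
  -- tensors.
  let l : E₁.A ⊗[k] E₂.A →ₗ[k] E.A := v.repr.symm.toLinearMap ∘ₗ diagCoord v₁ v₂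
  have hl : ∀ a t, j a = (E₁.balancing E₂).mkQ t → a = l t := fun a t e => by
    apply v.repr.injective
    rw [← hcoord, e, baerCoord_mkQ]
    simp [l]
  have hlv : ∀ s t x, l (v₁ (s, x) ⊗ₜ[k] v₂ (t, x)) = if s = t then v (s, x) else 0 := by
    intro s t x
    simp only [l, LinearMap.comp_apply, diagCoord_tmul]
    by_cases hst : s = t
    · simp [hst]
    · simp [hst]
  refine ⟨j, ?_, ?_, ?_, ?_, ?_, ?_⟩
  · intro a b hab
    apply v.repr.injective
    rw [← hcoord, ← hcoord, hab]
  · rw [map_mkQ_cotensor h₁ h₂, LinearMap.range_eq_map, ← v.span_eq, Submodule.map_span,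
      ← Set.range_comp]
    exact congrArg _ (congrArg _ (funext hj))
  · intro a b s hs t ht ha hb
    rw [hl a s ha, hl b t hb]
    clear ha hb
    induction hs using cotensor_induction h₁ h₂ with
    | zero => simp
    | add a b _ _ ha hb => rw [map_add, add_mul, map_add, ha, hb, add_mul, map_add]
    | smul r a _ ha => rw [map_smul, smul_mul_assoc, map_smul, ha, smul_mul_assoc, map_smul]
    | basis s s' x =>
      induction ht using cotensor_induction h₁ h₂ with
      | zero => simp
      | add a b _ _ ha hb => rw [map_add, mul_add, map_add, ha, hb, mul_add, map_add]
      | smul r a _ ha => rw [map_smul, mul_smul_comm, map_smul, ha, mul_smul_comm, map_smul]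
      | basis t t' y =>
        rw [hlv, hlv]
        by_cases hst : M.ract s x = t ∧ M.ract s' x = t'
        · obtain ⟨rfl, rfl⟩ := hst
          by_cases hs : s = s'
          · subst hs
            rw [if_pos rfl, if_pos rfl, mkQ_mul_baer h₁ h₂, h.mul_self, map_smul, hj]
          · rw [if_neg hs, zero_mul, map_zero, Algebra.TensorProduct.tmul_mul_tmul, h₁.mul_self,
              h₂.mul_self, TensorProduct.smul_tmul_smul, map_smul, mkQ_tmul_of_ne h₁ h₂ hs,
              smul_zero]
        · have h0 : (v₁ (s, x) ⊗ₜ[k] v₂ (s', x)) * (v₁ (t, y) ⊗ₜ[k] v₂ (t', y)) = 0 := by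
            rw [Algebra.TensorProduct.tmul_mul_tmul]
            by_cases h3 : M.ract s x = t
            · rw [h₂.mul_of_ne fun h4 => hst ⟨h3, h4⟩, TensorProduct.tmul_zero]
            · rw [h₁.mul_of_ne h3, TensorProduct.zero_tmul]
          rw [h0, map_zero]
          split_ifs with h3 h4
          · subst h3 h4
            rw [h.mul_of_ne fun h5 => hst ⟨h5, h5⟩, map_zero]
          all_goals simp
  · intro a t ht ha
    rw [hl a t ha]
    clear ha
    induction ht using cotensor_induction h₁ h₂ with
    | zero => simp
    | add a b _ _ ha hb => simp only [map_add, ha, hb]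
    | smul r a _ ha => simp only [map_smul, ha]
    | basis s t x =>
      rw [map_mkQ_comul h₁ h₂, hlv]
      split_ifs
      · rw [h.comul]
        simp only [map_sum, map_smul, TensorProduct.map_tmul, hj]
      · simp
  · intro f
    have h1 : j ∘ₗ (E.i : FunctionAlgebra k G →ₗ[k] E.A) =
        (E₁.balancing E₂).mkQ ∘ₗ (TensorProduct.mk k E₁.A E₂.A).flip 1 ∘ₗ
          (E₁.i : FunctionAlgebra k G →ₗ[k] E₁.A) := FunctionAlgebra.linearMap_ext fun s => by
      change j (E.i _) = (E₁.balancing E₂).mkQ (E₁.i (FunctionAlgebra.e k s) ⊗ₜ[k] 1)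
      rw [h.i_e, hj, mkQ_i_tmul_one h₁ h₂]
    exact LinearMap.congr_fun h1 f
  · intro a t ht ha
    rw [hl a t ha]
    clear ha
    induction ht using cotensor_induction h₁ h₂ with
    | zero => simp
    | add a b _ _ ha hb => simp only [map_add, ha, hb]
    | smul r a _ ha => simp only [map_smul, ha]
    | basis s t x =>
      rw [rid_map_π_counit h₁ h₂, hlv]
      by_cases hst : s = t
      · rw [if_pos hst, if_pos hst, h.π_v]
      · rw [if_neg hst, if_neg hst, map_zero]

/-- The embedding `j` identifies `E.A` with the span of the independent vectors `baerVec`; pulling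
them back gives the basis, and the defining clauses evaluate on their diagonal representatives. -/
theorem exists_of_isBaerProduct (h₁ : IsCrossedBasis c₁ E₁ v₁) (h₂ : IsCrossedBasis c₂ E₂ v₂)
    (h : HopfExtension.IsBaerProduct E₁ E₂ E) :
    ∃ v : Module.Basis (G × F) k E.A, IsCrossedBasis (c₁ * c₂) E v := by
  classical
  obtain ⟨j, hinj, hrange, hmul, hcomul, hi, hπ⟩ := h
  rw [map_mkQ_cotensor h₁ h₂] at hrange
  let v : Module.Basis (G × F) k E.A := (Module.Basis.span (linearIndependent_baerVec h₁ h₂)).map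
    ((LinearEquiv.ofEq _ _ hrange.symm).trans (LinearEquiv.ofInjective j hinj).symm)
  have hj : ∀ p, j (v p) = baerVec v₁ v₂ p := fun p => by
    have h1 : LinearEquiv.ofInjective j hinj (v p) = LinearEquiv.ofEq _ _ hrange.symm
        (Module.Basis.span (linearIndependent_baerVec h₁ h₂) p) := by
      simp [v]
    have h2 := congrArg Subtype.val h1
    rw [LinearEquiv.ofInjective_apply, LinearEquiv.coe_ofEq_apply, Module.Basis.span_apply] at h2
    exact h2
  have hmem : ∀ s x, v₁ (s, x) ⊗ₜ[k] v₂ (s, x) ∈ E₁.cotensor E₂ :=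
    fun s x => tmul_mem_cotensor h₁ h₂ s s x
  refine ⟨v, fun s x t y => ?_, fun s x => ?_, fun s => ?_, fun s x => ?_⟩
  · apply hinj
    rw [hmul _ _ _ (hmem s x) _ (hmem t y) (hj _) (hj _)]
    split_ifs with hst
    · subst hst
      rw [mkQ_mul_baer h₁ h₂, map_smul, hj]
    · rw [Algebra.TensorProduct.tmul_mul_tmul, h₁.mul_of_ne hst, TensorProduct.zero_tmul, map_zero,
        map_zero]
  · apply TensorProduct.map_injective_of_flat_flat j j hinj hinj
    rw [hcomul _ _ (hmem s x) (hj _), map_mkQ_comul h₁ h₂, if_pos rfl]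
    simp only [map_sum, map_smul, TensorProduct.map_tmul, hj]
  · apply hinj
    rw [hi, mkQ_i_tmul_one h₁ h₂, hj]
  · rw [hπ _ _ (hmem s x) (hj _), rid_map_π_counit h₁ h₂, if_pos rfl]

end Baer

end IsCrossedBasis

/-! ### Baer products as products of classes, and the main theorem -/

namespace Opext

variable {k G F : Type u} [Field k] [Group G] [Fintype G] [Group F] {M : MatchedPair G F}

/-- For the converse, equality of classes lets a crossed basis of `E` be rescaled until its cocycles
are exactly the products, and then `isBaerProduct` applies. -/
theorem isBaerProduct_iff (E₁ E₂ E : AbelianExtension k M) :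
    HopfExtension.IsBaerProduct E₁.toHopfExtension E₂.toHopfExtension E.toHopfExtension ↔
      cocycleClass E.toOpext = cocycleClass E₁.toOpext * cocycleClass E₂.toOpext := by
  obtain ⟨c₁, v₁, h₁⟩ := E₁.isCrossed
  obtain ⟨c₂, v₂, h₂⟩ := E₂.isCrossed
  rw [cocycleClass_toOpext h₁, cocycleClass_toOpext h₂, ← QuotientGroup.mk_mul]
  constructor
  · intro h
    obtain ⟨v, hv⟩ := h₁.exists_of_isBaerProduct h₂ h
    exact cocycleClass_toOpext hv
  · intro h
    obtain ⟨c, v, hv⟩ := E.isCrossed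
    rw [cocycleClass_toOpext hv] at h
    obtain ⟨w, hw⟩ := hv.exists_rescale (QuotientGroup.eq_iff_div_mem.1 h)
    exact h₁.isBaerProduct h₂ hw

end Opext

/-- The group law is transported from cocycle classes. Since every element of Opext is the class of
an extension, the equivalence for Baer products says that they exist, are unique up to equivalence,
and give this law. -/
theorem mainTheorem1 {k G F : Type u} [Field k] [Group G] [Fintype G] [Group F] [Finite F]
    (M : MatchedPair G F) :
    ∃ _ : CommGroup (Opext k M),
      (∀ E₁ E₂ E : AbelianExtension k M,
        HopfExtension.IsBaerProduct E₁.toHopfExtension E₂.toHopfExtension E.toHopfExtension ↔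
          E.toOpext = E₁.toOpext * E₂.toOpext) ∧
      Nonempty (Additive (Opext k M) ≃+
        AuslanderCohomology M.Bowtie M.CosetSet (TrivModule M.Bowtie (Additive kˣ)) 3) := by
  let := (Opext.equivCocycleClass k M).commGroup
  let e : Opext k M ≃* CocyclePair k M ⧸ CocyclePair.coboundaries k M :=
    (Opext.equivCocycleClass k M).mulEquiv
  refine ⟨inferInstance, fun E₁ E₂ E => ?_,
    ⟨MulEquiv.toAdditiveLeft (e.trans (M.cocycleClassEquivExt k))⟩⟩
  rw [Opext.isBaerProduct_iff, ← e.injective.eq_iff, map_mul]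
  rfl
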